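/- Let $k_1,\dots,k_5>0$ and $\gamma\in\mathbb{R}\setminus\{0\}$. For $x\in\mathbb{R}$, $t>0$ consider the two laminated Timoshenko beam systems with thermal coupling acting on the slip equation, i.e. with $(\tau_1,\tau_2,\tau_3)=(0,0,1)$, $$\begin{cases}\varphi_{tt}-k_1(\varphi_x+\psi+w)_x=0,\\ \psi_{tt}-k_2\psi_{xx}+k_1(\varphi_x+\psi+w)=0,\\ w_{tt}-k_3w_{xx}+k_1(\varphi_x+\psi+w)+\gamma q_{xt}=0,\\ q_{tt}-k_4q_{xx}+\mathcal{D}q_t+\gamma w_{xt}=0,\end{cases}$$ where $\mathcal{D}=-k_5\partial_x^2$ in case (1.6) and $\mathcal{D}=k_5$ in case (1.7). In the variables $U=(v,u,z,y,\phi,\theta,\sigma,\eta)=(\varphi_x+\psi+w,\varphi_t,\psi_x,\psi_t,w_x,w_t,q_x,q_t)$ they take the form of the Cauchy problem $$v_t-u_x-y-\theta=0,\quad u_t-k_1v_x=0,\quad z_t-y_x=0,\quad y_t-k_2z_x+k_1v=0,$$ $$\phi_t-\theta_x=0,\quad \theta_t-k_3\phi_x+k_1v+\gamma\eta_x=0,\quad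 \sigma_t-\eta_x=0,\quad \eta_t-k_4\sigma_x+\mathcal{D}\eta+\gamma\theta_x=0,$$ $U(\cdot,0)=U_0$. A solution is a function $U\in C([0,\infty);L^2(\mathbb{R};\mathbb{C}^8))$ with $U(\cdot,0)=U_0$ that satisfies these equations for $t>0$ in the sense of distributions in $x$ (after pairing with any Schwartz function of $x$, the equations hold pointwise in $t$). Let $N,\ell\in\mathbb{N}$ with $1\le\ell\le N$ and $j\in\{0,\dots,N-\ell\}$. Then there are constants $c_0,\tilde c_0>0$, depending only on $k_1,\dots,k_5,\gamma,N,\ell,j$, such that for every $U_0\in H^N(\mathbb{R})\cap L^1(\mathbb{R})$, every solution $U$ with initial data $U_0$ and every $t\ge0$, $\partial_x^jU(\cdot,t)$ is in $L^2(\mathbb{R})$ and the following holds. In case (1.6), if $k_1=k_2=k_3$, $$\|\partial_x^jU(t)\|_{L^2}\le c_0(1+t)^{-1/12-j/6}\|U_0\|_{L^1}+c_0e^{-\tilde c_0t}\|\partial_x^{j+\ell}U_0\|_{L^2},$$ and otherwise $$\|\partial_x^jU(t)\|_{L^2}\le c_0(1+t)^{-1/12-j/6}\|U_0\|_{L^1}+c_0(1+t)^{-\ell/4}\|\partial_x^{j+\ell}U_0\|_{L^2}.$$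 In case (1.7), if $k_1=k_2=k_3$, $$\|\partial_x^jU(t)\|_{L^2}\le c_0(1+t)^{-1/8-j/4}\|U_0\|_{L^1}+c_0(1+t)^{-\ell/2}\|\partial_x^{j+\ell}U_0\|_{L^2},$$ and otherwise $$\|\partial_x^jU(t)\|_{L^2}\le c_0(1+t)^{-1/8-j/4}\|U_0\|_{L^1}+c_0(1+t)^{-\ell/4}\|\partial_x^{j+\ell}U_0\|_{L^2}.$$ Moreover, in case (1.6) with $k_1=k_2=k_3$ there is no regularity loss: the estimate is also valid with $\ell=0$, that is, for all $N\ge0$, $0\le j\le N$ and $U_0\in H^N(\mathbb{R})\cap L^1(\mathbb{R})$, $$\|\partial_x^jU(t)\|_{L^2}\le c_0(1+t)^{-1/12-j/6}\|U_0\|_{L^1}+c_0e^{-\tilde c_0t}\|\partial_x^{j}U_0\|_{L^2}.$$ -/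

import Mathlib

open MeasureTheory
open scoped SchwartzMap LineDeriv

noncomputable section

namespace LaminatedBeam

/-- The values of the unknown `U = (v, u, z, y, φ, θ, σ, η)`, with the Euclidean norm
`|U|² = |v|² + |u|² + |z|² + |y|² + |φ|² + |θ|² + |σ|² + |η|²`. -/
abbrev Vec : Type := EuclideanSpace ℂ (Fin 8)

/-- The space `L²(ℝ)` of (classes of) functions with values in `Vec`. -/
abbrev L2 : Type := Lp Vec 2 (volume : Measure ℝ)

/-- The derivative `∂ₓ` of a tempered distribution on the real line. -/
def dx (f : 𝓢'(ℝ, Vec)) : 𝓢'(ℝ, Vec) := ∂_{(1 : ℝ)} f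

/-- `g` is the derivative `∂ₓ^j f` in `L²(ℝ)`, in the sense of distributions. It is unique. -/
def IsL2Deriv (j : ℕ) (f g : L2) : Prop :=
  (g : 𝓢'(ℝ, Vec)) = dx^[j] (f : 𝓢'(ℝ, Vec))

/-- The two kinds of thermal dissipation: the term `-k₅ q_{xxt}` or the term `k₅ q_t` in the
equation for `q`. -/
inductive Dissipation where
  | higherOrder
  | lowerOrder

/-- `ε₀ = 1` for the dissipation `-k₅ q_{xxt}`, and `ε₀ = 0` for `k₅ q_t`. -/
def Dissipation.eps : Dissipation → ℂ
  | .higherOrder => 1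
  | .lowerOrder => 0

/-- The coefficients of the model. -/
structure Coeffs where
  (k₁ k₂ k₃ k₄ k₅ γ τ₁ τ₂ τ₃ : ℝ)

/-- The matrix of `U ↦ A₂ U`, acting on `(v, u, z, y, φ, θ, σ, η)`. -/
def A₂ (d : Dissipation) (p : Coeffs) : Matrix (Fin 8) (Fin 8) ℂ :=
  !![0, 0, 0, 0, 0, 0, 0, 0;
     0, 0, 0, 0, 0, 0, 0, 0;
     0, 0, 0, 0, 0, 0, 0, 0;
     0, 0, 0, 0, 0, 0, 0, 0;
     0, 0, 0, 0, 0, 0, 0, 0;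
     0, 0, 0, 0, 0, 0, 0, 0;
     0, 0, 0, 0, 0, 0, 0, 0;
     0, 0, 0, 0, 0, 0, 0, -(d.eps * p.k₅)]

/-- The matrix of `U ↦ A₁ U`, acting on `(v, u, z, y, φ, θ, σ, η)`. -/
def A₁ (p : Coeffs) : Matrix (Fin 8) (Fin 8) ℂ :=
  !![0, -1, 0, 0, 0, 0, 0, 0;
     -p.k₁, 0, 0, 0, 0, 0, 0, p.τ₁ * p.γ;
     0, 0, 0, -1, 0, 0, 0, 0;
     0, 0, -p.k₂, 0, 0, 0, 0, p.τ₂ * p.γ;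
     0, 0, 0, 0, 0, -1, 0, 0;
     0, 0, 0, 0, -p.k₃, 0, 0, p.τ₃ * p.γ;
     0, 0, 0, 0, 0, 0, 0, -1;
     0, p.γ * p.τ₁, 0, p.γ * p.τ₂, 0, p.γ * p.τ₃, -p.k₄, 0]

/-- The matrix of `U ↦ A₀ U`, acting on `(v, u, z, y, φ, θ, σ, η)`. -/
def A₀ (d : Dissipation) (p : Coeffs) : Matrix (Fin 8) (Fin 8) ℂ :=
  !![0, 0, 0, -1, 0, -1, 0, 0;
     0, 0, 0, 0, 0, 0, 0, 0;
     0, 0, 0, 0, 0, 0, 0, 0;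
     p.k₁, 0, 0, 0, 0, 0, 0, 0;
     0, 0, 0, 0, 0, 0, 0, 0;
     p.k₁, 0, 0, 0, 0, 0, 0, 0;
     0, 0, 0, 0, 0, 0, 0, 0;
     0, 0, 0, 0, 0, 0, 0, (1 - d.eps) * p.k₅]

/-- The action of a matrix on `Vec`. -/
def act (A : Matrix (Fin 8) (Fin 8) ℂ) (X : Vec) : Vec := Matrix.toEuclideanLin A X

/-- `U ∈ C([0, ∞); L²(ℝ))` is a (weak) solution of
`U_t + A₂ U_{xx} + A₁ U_x + A₀ U = 0` for `t > 0`, with `U(·, 0) = U₀`: the equation holds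
when paired with every test function `w` of the space variable. -/
structure IsSolution (d : Dissipation) (p : Coeffs) (U₀ : L2) (U : ℝ → L2) : Prop where
  continuousOn : ContinuousOn U (Set.Ici 0)
  initial : U 0 = U₀
  equation : ∀ w : 𝓢(ℝ, ℂ), ∀ t : ℝ, 0 < t →
    HasDerivAt (fun s : ℝ => (U s : 𝓢'(ℝ, Vec)) w)
      (-(act (A₂ d p) (dx (dx (U t : 𝓢'(ℝ, Vec))) w)
        + act (A₁ p) (dx (U t : 𝓢'(ℝ, Vec)) w)
        + act (A₀ d p) ((U t : 𝓢'(ℝ, Vec)) w))) t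

/-- `‖∂ₓ^j U(t)‖_{L²} ≤ a(t) ‖U₀‖_{L¹} + b(t) ‖∂ₓ^{j+l} U₀‖_{L²}` for all `t ≥ 0` (it is part of
the claim that both derivatives exist in `L²`). -/
def DecayEstimate (j l : ℕ) (a b : ℝ → ℝ) (U₀ : L2) (U : ℝ → L2) : Prop :=
  ∀ t : ℝ, 0 ≤ t → ∃ V W : L2, IsL2Deriv j (U t) V ∧ IsL2Deriv (j + l) U₀ W ∧
    ‖V‖ ≤ a t * (∫ x, ‖U₀ x‖) + b t * ‖W‖

/-- `U₀ ∈ H^N(ℝ) ∩ L¹(ℝ)`. -/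
def AdmissibleData (N : ℕ) (U₀ : L2) : Prop :=
  TemperedDistribution.MemSobolev (N : ℝ) 2 (U₀ : 𝓢'(ℝ, Vec)) ∧ Integrable U₀ volume

end LaminatedBeam

end

/-! After a Fourier transform the system is a linear ODE in `ℂ⁸` at each frequency `s = 2πξ`.
Multiplying `u, z, φ, η` by `-i` makes its coefficients real, so real and imaginary parts are
treated separately as a `Mode`. The energy of a mode decreases only through `2Dη²`, where `D` is
`k₅s²` or `k₅`. Quadratic multipliers carry this dissipation to the other components along the chain
`η → (θ, σ) → (v, φ) → (u, y) → z`. Each link has a sign in its own components and leaves errors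
absorbed by its neighbours (`Mode.IsWeight.controlled_main`). Subtracting the multipliers from a
large multiple of the energy gives a Lyapunov functional (`Mode.Controlled.decay`), hence `|Û(t)|² ≤
C exp(-c f(s) t) |Û(0)|²`.

With `ρ = 1/(1+s²)` and a weight `m` (`ρ` for the damping `k₅`, `ρ²s²` for `k₅s²`), the chain yields
`f = mρ³s⁴` for all coefficients. Equal wave speeds cancel the `vz` and `vφ` cross terms in
multipliers without a factor `s`. This gives `f = ρ³s⁴` for the damping `k₅` and `f = ρ³s⁶` for
`k₅s²`, and the latter is bounded below at high frequencies.

A weak solution must satisfy `Û(t) = exp(t·symbol) Û₀` almost everywhere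
(`IsSolution.fourier_ae_eq`). Plancherel then reduces the claim to `f`. For `|s| ≤ 1`, `f ≳ |s|^n`
and `|Û₀| ≤ ‖U₀‖_{L¹}` give the power `-1/(2n) - j/n`. For `|s| ≥ 1`, `f ≳ |s|^{-m'}` turns `l`
extra derivatives into the decay `(1+t)^{-l/m'}`, and a rate bounded below gives exponential decay
with no derivative spent (`exists_decayEstimate`). -/

namespace LaminatedBeam

open scoped BoundedContinuousFunction FourierTransform

/-! ### Modes at a fixed frequency and the Lyapunov argument -/

/-- A solution of the ordinary differential equation satisfied, at a fixed frequency `s`, by the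
real and by the imaginary parts of `(v, -iu, -iz, y, -iφ, θ, σ, -iη)`, with damping `D`. -/
structure Mode (p : Coeffs) where
  (s D : ℝ)
  (v u z y φ θ σ η : ℝ → ℝ)
  D_nonneg : 0 ≤ D
  hv : ∀ t, HasDerivAt v (-s * u t + y t + θ t) t
  hu : ∀ t, HasDerivAt u (s * p.k₁ * v t) t
  hz : ∀ t, HasDerivAt z (s * y t) t
  hy : ∀ t, HasDerivAt y (-s * p.k₂ * z t - p.k₁ * v t) t
  hφ : ∀ t, HasDerivAt φ (s * θ t) t
  hθ : ∀ t, HasDerivAt θ (-s * p.k₃ * φ t - p.k₁ * v t + s * p.γ * η t) t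
  hσ : ∀ t, HasDerivAt σ (-s * η t) t
  hη : ∀ t, HasDerivAt η (s * p.k₄ * σ t - D * η t - s * p.γ * θ t) t

namespace Mode

variable {p : Coeffs}

/-- The energy of a mode. -/
def energy (X : Mode p) (t : ℝ) : ℝ :=
  p.k₁ * X.v t ^ 2 + X.u t ^ 2 + p.k₂ * X.z t ^ 2 + X.y t ^ 2 + p.k₃ * X.φ t ^ 2 + X.θ t ^ 2
    + p.k₄ * X.σ t ^ 2 + X.η t ^ 2

/-- The Euclidean norm squared of a mode. -/
def normSq (X : Mode p) (t : ℝ) : ℝ :=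
  X.v t ^ 2 + X.u t ^ 2 + X.z t ^ 2 + X.y t ^ 2 + X.φ t ^ 2 + X.θ t ^ 2
    + X.σ t ^ 2 + X.η t ^ 2

theorem normSq_nonneg (X : Mode p) (t : ℝ) : 0 ≤ X.normSq t := by
  unfold normSq; positivity

/-- All couplings are skew for the inner product weighted by the `kᵢ`, so only the damping of `η`
survives. -/
theorem hasDerivAt_energy (X : Mode p) (t : ℝ) :
    HasDerivAt X.energy (-2 * X.D * X.η t ^ 2) t := by
  have h := ((((((((X.hv t).pow 2).const_mul p.k₁).add ((X.hu t).pow 2)).add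
    (((X.hz t).pow 2).const_mul p.k₂)).add ((X.hy t).pow 2)).add
    (((X.hφ t).pow 2).const_mul p.k₃)).add ((X.hθ t).pow 2)).add
    (((X.hσ t).pow 2).const_mul p.k₄) |>.add ((X.hη t).pow 2)
  refine h.congr_deriv ?_
  simp
  ring

/-- `Q` is, up to the derivative of a quantity bounded by the energy, bounded by the dissipation,
uniformly for the modes in `S`. -/
def Controlled (S : Set (Mode p)) (Q : Mode p → ℝ → ℝ) : Prop :=
  ∃ C : ℝ, ∀ X ∈ S, ∃ B B' : ℝ → ℝ, ∀ t, HasDerivAt B (B' t) t ∧ |B t| ≤ C * X.normSq t ∧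
    Q X t ≤ B' t + C * (X.D * X.η t ^ 2)

variable {S : Set (Mode p)} {Q R : Mode p → ℝ → ℝ}

theorem Controlled.mono (h : Controlled S Q) (hR : ∀ X ∈ S, ∀ t, R X t ≤ Q X t) :
    Controlled S R := by
  obtain ⟨C, hC⟩ := h
  refine ⟨C, fun X hX => ?_⟩
  obtain ⟨B, B', h⟩ := hC X hX
  exact ⟨B, B', fun t => ⟨(h t).1, (h t).2.1, (hR X hX t).trans (h t).2.2⟩⟩

theorem Controlled.add (h : Controlled S Q) (h' : Controlled S R) :
    Controlled S (fun X t => Q X t + R X t) := by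
  obtain ⟨C, hC⟩ := h
  obtain ⟨C', hC'⟩ := h'
  refine ⟨C + C', fun X hX => ?_⟩
  obtain ⟨B, B', h⟩ := hC X hX
  obtain ⟨B1, B1', h1⟩ := hC' X hX
  refine ⟨fun t => B t + B1 t, fun t => B' t + B1' t, fun t =>
    ⟨(h t).1.add (h1 t).1, ?_, ?_⟩⟩
  · refine (abs_add_le _ _).trans ?_
    linarith [(h t).2.1, (h1 t).2.1]
  · linarith [(h t).2.2, (h1 t).2.2]

theorem Controlled.const_mul (h : Controlled S Q) {c : ℝ} (hc : 0 ≤ c) :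
    Controlled S (fun X t => c * Q X t) := by
  obtain ⟨C, hC⟩ := h
  refine ⟨c * C, fun X hX => ?_⟩
  obtain ⟨B, B', h⟩ := hC X hX
  refine ⟨fun t => c * B t, fun t => c * B' t, fun t => ⟨(h t).1.const_mul c, ?_, ?_⟩⟩
  · rw [abs_mul, abs_of_nonneg hc, mul_assoc]
    exact mul_le_mul_of_nonneg_left (h t).2.1 hc
  · nlinarith [mul_le_mul_of_nonneg_left (h t).2.2 hc]

/-- This and the next lemma are the two sources of controlled quantities: exact derivatives of
bounded multipliers, and multiples of `η²` paid by the damping. Sums, nonnegative multiples and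
smaller quantities follow. -/
theorem controlled_deriv (C : ℝ) {B B' : Mode p → ℝ → ℝ}
    (hB : ∀ X ∈ S, ∀ t, HasDerivAt (B X) (B' X t) t)
    (hC : ∀ X ∈ S, ∀ t, |B X t| ≤ C * X.normSq t) : Controlled S B' := by
  refine ⟨max C 0, fun X hX => ⟨B X, B' X, fun t => ⟨hB X hX t, (hC X hX t).trans ?_, ?_⟩⟩⟩
  · exact mul_le_mul_of_nonneg_right (le_max_left _ _) (X.normSq_nonneg t)
  · have := X.D_nonneg
    have : 0 ≤ max C 0 * (X.D * X.η t ^ 2) := by positivity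
    linarith

theorem controlled_dissipation (C : ℝ) (w : Mode p → ℝ) (hC : ∀ X ∈ S, w X ≤ C * X.D) :
    Controlled S (fun X t => w X * X.η t ^ 2) := by
  refine ⟨max C 0, fun X hX => ⟨fun _ => 0, fun _ => 0, fun t => ⟨hasDerivAt_const _ _, ?_, ?_⟩⟩⟩
  · have := X.normSq_nonneg t
    simp; positivity
  · have h1 := X.D_nonneg
    have : w X ≤ max C 0 * X.D :=
      (hC X hX).trans (mul_le_mul_of_nonneg_right (le_max_left _ _) h1)
    nlinarith [mul_le_mul_of_nonneg_right this (sq_nonneg (X.η t))]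

/-- A controlled quantity which dominates `f` times the norm gives decay at the rate `f`. -/
theorem Controlled.decay (h : Controlled S Q) (hk₁ : 0 < p.k₁) (hk₂ : 0 < p.k₂) (hk₃ : 0 < p.k₃)
    (hk₄ : 0 < p.k₄) {f : Mode p → ℝ} (hf : ∀ X ∈ S, 0 ≤ f X)
    (hQ : ∀ X ∈ S, ∀ t, f X * X.normSq t ≤ Q X t) :
    ∃ C > 0, ∃ c > 0, ∀ X ∈ S, ∀ t, 0 ≤ t →
      X.normSq t ≤ C * Real.exp (-c * f X * t) * X.normSq 0 := by
  obtain ⟨C, hC⟩ := h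
  set C₁ := max C 0
  have hC₁ : 0 ≤ C₁ := le_max_right _ _
  obtain ⟨a, ha, ha1, ha2, ha3, ha4, ha5⟩ : ∃ a > 0, a ≤ p.k₁ ∧ a ≤ p.k₂ ∧ a ≤ p.k₃ ∧ a ≤ p.k₄ ∧
      a ≤ 1 := by
    refine ⟨min (min p.k₁ p.k₂) (min (min p.k₃ p.k₄) 1), by positivity, ?_, ?_, ?_, ?_, ?_⟩ <;>
      simp
  set b := p.k₁ + p.k₂ + p.k₃ + p.k₄ + 1 with hb
  -- Since `N * a = C₁ + 1`, the functional `N * energy - B` dominates `normSq`. Since `a ≤ 1`, also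
  -- `C₁ ≤ 2N`, so the energy dissipation absorbs the `η²` error of `B`.
  set N := (C₁ + 1) / a with hN
  have hNp : 0 < N := by positivity
  have hNC : C₁ ≤ 2 * N := by
    have : N * a = C₁ + 1 := by rw [hN]; field_simp
    nlinarith
  have hbp : 0 < b := by positivity
  refine ⟨N * b + C₁, by positivity, 1 / (N * b + C₁), by positivity, fun X hX t ht => ?_⟩
  obtain ⟨B, B', hB⟩ := hC X hX
  set K := N * b + C₁ with hK
  have hKp : 0 < K := by positivity
  have hlow : ∀ t, X.normSq t ≤ N * X.energy t - B t := by
    intro t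
    have h1 : a * X.normSq t ≤ X.energy t := by
      unfold normSq energy
      nlinarith [sq_nonneg (X.v t), sq_nonneg (X.u t), sq_nonneg (X.z t), sq_nonneg (X.y t),
        sq_nonneg (X.φ t), sq_nonneg (X.θ t), sq_nonneg (X.σ t), sq_nonneg (X.η t)]
    have h2 : B t ≤ C₁ * X.normSq t := (le_abs_self _).trans ((hB t).2.1.trans
      (mul_le_mul_of_nonneg_right (le_max_left _ _) (X.normSq_nonneg t)))
    have h3 : N * (a * X.normSq t) = (C₁ + 1) * X.normSq t := by
      rw [hN]; field_simp
    have := mul_le_mul_of_nonneg_left h1 hNp.le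
    linarith
  have hup : ∀ t, N * X.energy t - B t ≤ K * X.normSq t := by
    intro t
    have h1 : X.energy t ≤ b * X.normSq t := by
      unfold normSq energy
      nlinarith [sq_nonneg (X.v t), sq_nonneg (X.u t), sq_nonneg (X.z t), sq_nonneg (X.y t),
        sq_nonneg (X.φ t), sq_nonneg (X.θ t), sq_nonneg (X.σ t), sq_nonneg (X.η t)]
    have h2 : -B t ≤ C₁ * X.normSq t := (neg_le_abs _).trans ((hB t).2.1.trans
      (mul_le_mul_of_nonneg_right (le_max_left _ _) (X.normSq_nonneg t)))
    have := mul_le_mul_of_nonneg_left h1 hNp.le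
    rw [hK]; linarith
  -- Gronwall in integrated form: the Lyapunov functional times its expected growth factor is
  -- nonincreasing.
  set g : ℝ → ℝ := fun τ => (N * X.energy τ - B τ) * Real.exp (1 / K * f X * τ) with hg
  have hg' : ∀ τ, HasDerivAt g ((N * (-2 * X.D * X.η τ ^ 2) - B' τ) *
      Real.exp (1 / K * f X * τ) + (N * X.energy τ - B τ) *
        (Real.exp (1 / K * f X * τ) * (1 / K * f X * 1))) τ := fun τ =>
    (((X.hasDerivAt_energy τ).const_mul N).sub (hB τ).1).mul
      (((hasDerivAt_id τ).const_mul (1 / K * f X)).exp)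
  have hanti : Antitone g := by
    refine antitone_of_hasDerivAt_nonpos hg' fun τ => ?_
    have h1 := hQ X hX τ
    have h2 : Q X τ ≤ B' τ + C₁ * (X.D * X.η τ ^ 2) := by
      have h3 : 0 ≤ X.D * X.η τ ^ 2 := mul_nonneg X.D_nonneg (sq_nonneg _)
      have := mul_le_mul_of_nonneg_right (le_max_left C 0) h3
      exact (hB τ).2.2.trans (by simpa [C₁] using this)
    have h4 : 1 / K * f X * (N * X.energy τ - B τ) ≤ f X * X.normSq τ := by
      have h5 := mul_le_mul_of_nonneg_left (hup τ) (hf X hX)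
      calc _ = f X * (N * X.energy τ - B τ) / K := by ring
        _ ≤ f X * (K * X.normSq τ) / K := by gcongr
        _ = _ := by field_simp
    have h6 : 0 ≤ (2 * N - C₁) * (X.D * X.η τ ^ 2) :=
      mul_nonneg (by linarith) (mul_nonneg X.D_nonneg (sq_nonneg _))
    have h7 := Real.exp_pos (1 / K * f X * τ)
    have h8 : (N * (-2 * X.D * X.η τ ^ 2) - B' τ) + 1 / K * f X * (N * X.energy τ - B τ) ≤ 0 := by
      nlinarith
    show _ ≤ (0 : ℝ)
    nlinarith [mul_nonpos_of_nonpos_of_nonneg h8 h7.le]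
  have h1 := hanti ht
  have h2 : g 0 ≤ K * X.normSq 0 := by simpa [hg] using hup 0
  have h3 : X.normSq t * Real.exp (1 / K * f X * t) ≤ g t :=
    mul_le_mul_of_nonneg_right (hlow t) (Real.exp_pos _).le
  have h4 : X.normSq t * Real.exp (1 / K * f X * t) ≤ K * X.normSq 0 := by linarith
  calc X.normSq t = X.normSq t * Real.exp (1 / K * f X * t) * Real.exp (-(1 / K) * f X * t) := by
        rw [mul_assoc, ← Real.exp_add]; ring_nf; simp
    _ ≤ K * X.normSq 0 * Real.exp (-(1 / K) * f X * t) := by gcongr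
    _ = _ := by ring

end Mode

/-! ### Algebraic inequalities behind the multipliers -/

theorem exists_young (c : ℝ) {ε : ℝ} (hε : 0 < ε) :
    ∃ K ≥ 0, ∀ a b : ℝ, c * (a * b) ≤ ε * a ^ 2 + K * b ^ 2 := by
  refine ⟨c ^ 2 / (4 * ε), by positivity, fun a b => ?_⟩
  have h : ε * a ^ 2 + c ^ 2 / (4 * ε) * b ^ 2 - c * (a * b) = ε * (a - c / (2 * ε) * b) ^ 2 := by
    field_simp; ring
  have : 0 ≤ ε * (a - c / (2 * ε) * b) ^ 2 := by positivity
  linarith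

/-- Young's inequality for `a` and `r * b`, multiplied by `ρ = 1/r`. It serves when `a` is only
available with the degenerate weight `ρ`. -/
theorem exists_young_weight (c : ℝ) {ε : ℝ} (hε : 0 < ε) :
    ∃ K ≥ 0, ∀ r ρ a b : ℝ, 0 < ρ → ρ * r = 1 →
      c * (a * b) ≤ ε * (ρ * a ^ 2) + K * (r * b ^ 2) := by
  obtain ⟨K, hK, h⟩ := exists_young c hε
  refine ⟨K, hK, fun r ρ a b hρ hr => ?_⟩
  have h1 := mul_le_mul_of_nonneg_left (h a (r * b)) hρ.le
  have h2 : ρ * (c * (a * (r * b))) = c * (a * b) := by linear_combination c * a * b * hr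
  have h3 : ρ * (ε * a ^ 2 + K * (r * b) ^ 2) = ε * (ρ * a ^ 2) + K * (r * b ^ 2) := by
    linear_combination K * b ^ 2 * r * hr
  linarith

namespace Mode

variable {p : Coeffs}

/-- The inverse of `1 + s²`. -/
noncomputable def ρ (X : Mode p) : ℝ := (1 + X.s ^ 2)⁻¹

theorem ρ_pos (X : Mode p) : 0 < X.ρ := by unfold ρ; positivity

theorem ρ_mul (X : Mode p) : X.ρ * (1 + X.s ^ 2) = 1 := by
  unfold ρ; field_simp

theorem ρ_le (X : Mode p) : X.ρ ≤ 1 := by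
  nlinarith [X.ρ_mul, X.ρ_pos, mul_nonneg X.ρ_pos.le (sq_nonneg X.s)]

theorem ρ_mul_sq_le (X : Mode p) : X.ρ * X.s ^ 2 ≤ 1 := by
  nlinarith [X.ρ_mul, X.ρ_pos]

variable {S : Set (Mode p)} {m : Mode p → ℝ}

/-- The functional controlling `θ` and `σ`. -/
theorem exists_heat_ineq (hk₄ : 0 < p.k₄) (hγ : p.γ ≠ 0) : ∃ a > 0, ∀ δ > 0, ∃ K ≥ 0,
    ∀ s D ρ v φ θ σ η : ℝ, 0 < ρ → ρ * (1 + s ^ 2) = 1 →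
      a * (s ^ 2 * (θ ^ 2 + σ ^ 2)) - δ * (ρ * (s ^ 2 * (s ^ 2 * φ ^ 2 + v ^ 2))) ≤
        (s ^ 2 * p.k₄ * σ ^ 2 + s ^ 2 * p.γ ^ 2 * θ ^ 2 - s ^ 2 * (1 + p.γ ^ 2) * η ^ 2
          - s * D * η * (σ - p.γ * θ) + (p.γ * (p.k₃ - p.k₄) - p.γ) * s ^ 2 * η * φ
          + p.γ * p.k₁ * s * η * v) + K * ((1 + s ^ 2 + D ^ 2) * η ^ 2) := by
  have hγ2 : 0 < p.γ ^ 2 := by positivity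
  refine ⟨min p.k₄ (p.γ ^ 2) / 2, by positivity, fun δ hδ => ?_⟩
  obtain ⟨K1, hK1, h1⟩ := exists_young 1 (ε := min p.k₄ (p.γ ^ 2) / 2) (by positivity)
  obtain ⟨K2, hK2, h2⟩ := exists_young (-p.γ) (ε := min p.k₄ (p.γ ^ 2) / 2) (by positivity)
  obtain ⟨K3, hK3, h3⟩ := exists_young_weight (-(p.γ * (p.k₃ - p.k₄) - p.γ)) hδ
  obtain ⟨K4, hK4, h4⟩ := exists_young_weight (-(p.γ * p.k₁)) hδ
  refine ⟨(1 + p.γ ^ 2) + K1 + K2 + K3 + K4, by positivity,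
    fun s D ρ v φ θ σ η hρ hr => ?_⟩
  have e1 := h1 (s * σ) (D * η)
  have e2 := h2 (s * θ) (D * η)
  -- The later control of `φ` and `v` carries a factor `ρ`. Matching it costs `(1 + s²)η²`, one
  -- reason for the damping condition in `IsWeight`.
  have e3 := h3 _ ρ (s ^ 2 * φ) η hρ hr
  have e4 := h4 _ ρ (s * v) η hρ hr
  have e5 := mul_le_mul_of_nonneg_right (min_le_left p.k₄ (p.γ ^ 2)) (sq_nonneg (s * σ))
  have e6 := mul_le_mul_of_nonneg_right (min_le_right p.k₄ (p.γ ^ 2)) (sq_nonneg (s * θ))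
  have q1 : 0 ≤ (K1 + K2) * ((1 + s ^ 2) * η ^ 2) := by positivity
  have q2 : 0 ≤ (K3 + K4 + (1 + p.γ ^ 2)) * (D ^ 2 * η ^ 2) := by positivity
  have q3 : 0 ≤ (1 + p.γ ^ 2) * η ^ 2 := by positivity
  nlinarith

/-- The functional controlling `v` and `φ`. -/
theorem exists_shear_ineq (hk₁ : 0 < p.k₁) (hk₃ : 0 < p.k₃) : ∃ a > 0, ∀ δ > 0, ∃ K ≥ 0,
    ∀ s ρ v u y φ θ η : ℝ, 0 < ρ → ρ * (1 + s ^ 2) = 1 →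
      a * (ρ * (s ^ 2 * (s ^ 2 * φ ^ 2 + v ^ 2))) - K * (s ^ 2 * θ ^ 2)
        - δ * (ρ ^ 2 * (s ^ 2 * (y ^ 2 + s ^ 2 * u ^ 2))) ≤
      -(ρ * s ^ 2) * (-(s ^ 2 * p.k₃ ^ 2 * φ ^ 2) - p.k₁ ^ 2 * v ^ 2
        + s * p.γ * η * (s * p.k₃ * φ + p.k₁ * v)
        + (s ^ 2 * p.k₃ + p.k₁) * θ ^ 2 + (2 * p.k₃ - p.k₁) * (s * u * θ) + p.k₁ * (y * θ))
        + K * ((1 + s ^ 2) * η ^ 2) := by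
  set a := min (p.k₁ ^ 2) (p.k₃ ^ 2) with ha
  have ha0 : 0 < a := by positivity
  refine ⟨a / 2, by positivity, fun δ hδ => ?_⟩
  obtain ⟨K1, hK1, h1⟩ := exists_young (p.γ * p.k₃) (ε := a / 2) (by positivity)
  obtain ⟨K2, hK2, h2⟩ := exists_young (p.γ * p.k₁) (ε := a / 2) (by positivity)
  obtain ⟨K3, hK3, h3⟩ := exists_young (2 * p.k₃ - p.k₁) hδ
  obtain ⟨K4, hK4, h4⟩ := exists_young (p.k₁) hδ
  refine ⟨K1 + K2 + K3 + K4 + p.k₃ + p.k₁, by positivity,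
    fun s ρ v u y φ θ η hρ hr => ?_⟩
  have hρs : ρ * s ^ 2 ≤ 1 := by nlinarith
  have hρs0 : 0 ≤ ρ * s ^ 2 := by positivity
  have hρ1 : ρ ≤ 1 := by nlinarith
  have e1 := mul_le_mul_of_nonneg_left (h1 (s * φ) (s * η)) hρs0
  have e2 := mul_le_mul_of_nonneg_left (h2 v (s * η)) hρs0
  -- The whole factor `ρ` goes to `u` and `y`, so the errors appear with `ρ²`, the weight provided
  -- by the rotation functional.
  have e3 := h3 (ρ * s ^ 2 * u) (s * θ)
  have e4 := h4 (ρ * s * y) (s * θ)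
  have e5 := mul_le_mul_of_nonneg_left (mul_le_mul_of_nonneg_right
    (min_le_left (p.k₁ ^ 2) (p.k₃ ^ 2)) (sq_nonneg v)) hρs0
  have e6 := mul_le_mul_of_nonneg_left (mul_le_mul_of_nonneg_right
    (min_le_right (p.k₁ ^ 2) (p.k₃ ^ 2)) (sq_nonneg (s * φ))) hρs0
  have q1 : ρ * s ^ 2 * (K1 * (s * η) ^ 2) ≤ K1 * (s * η) ^ 2 :=
    mul_le_of_le_one_left (by positivity) hρs
  have q2 : ρ * s ^ 2 * (K2 * (s * η) ^ 2) ≤ K2 * (s * η) ^ 2 :=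
    mul_le_of_le_one_left (by positivity) hρs
  have q3 : ρ * s ^ 2 * (p.k₃ * (s * θ) ^ 2) ≤ p.k₃ * (s * θ) ^ 2 :=
    mul_le_of_le_one_left (by positivity) hρs
  have q4 : ρ * (p.k₁ * (s * θ) ^ 2) ≤ p.k₁ * (s * θ) ^ 2 :=
    mul_le_of_le_one_left (by positivity) hρ1
  have q5 : 0 ≤ (K1 + K2) * (s ^ 2 * θ ^ 2) := by positivity
  have q6 : 0 ≤ (K1 + K2) * η ^ 2 := by positivity
  have q7 : 0 ≤ (K3 + K4 + p.k₃ + p.k₁) * ((1 + s ^ 2) * η ^ 2) := by positivity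
  linarith

/-- The functional controlling `u` and `y`. -/
theorem exists_rotation_ineq (hk₁ : 0 < p.k₁) {κ : ℝ} (hκ : 0 < κ) : ∃ a > 0, ∃ K ≥ 0,
    ∀ s ρ v u y θ : ℝ, 0 < ρ → ρ * (1 + s ^ 2) = 1 →
      a * (ρ ^ 2 * (s ^ 2 * (y ^ 2 + s ^ 2 * u ^ 2)))
        - K * (ρ * (s ^ 2 * v ^ 2) + s ^ 2 * θ ^ 2) ≤
      ρ ^ 2 * s ^ 2 * (y ^ 2 + (1 + κ) * (s ^ 2 * u ^ 2) - 2 * (s * u * y) + y * θ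
        - (1 + κ) * (s * u * θ) - p.k₁ * (1 + (1 + κ) * s ^ 2) * v ^ 2) := by
  -- With this `a`, `(1 - a)(1 + κ - a) - 1 = a²`, so `x² + (1+κ)w² - 2wx` stays nonnegative after
  -- subtracting `a(x² + w²)`; completing the square shows it.
  set a := κ / (2 + κ) with ha
  have ha0 : 0 < a := by positivity
  have haκ : a * (2 + κ) = κ := by rw [ha]; field_simp
  obtain ⟨K3, hK3, h3⟩ := exists_young (-1) (ε := a / 2) (by positivity)
  obtain ⟨K4, hK4, h4⟩ := exists_young (1 + κ) (ε := a / 2) (by positivity)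
  refine ⟨a / 2, by positivity, K3 + K4 + p.k₁ * (1 + κ), by positivity,
    fun s ρ v u y θ hρ hr => ?_⟩
  have hρ1 : ρ ≤ 1 := by nlinarith
  have hq : ∀ x w : ℝ, a * (x ^ 2 + w ^ 2) ≤ x ^ 2 + (1 + κ) * w ^ 2 - 2 * (w * x) := by
    intro x w
    have h1 : 0 < 1 - a := by
      have : a * (2 + κ) < 1 * (2 + κ) := by linarith
      nlinarith [lt_of_mul_lt_mul_right this (by positivity)]
    have h2 : (1 - a) * (x ^ 2 + (1 + κ) * w ^ 2 - 2 * (w * x) - a * (x ^ 2 + w ^ 2))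
        = ((1 - a) * x - w) ^ 2 + a ^ 2 * w ^ 2 := by
      linear_combination (-w ^ 2) * haκ
    have h3 : 0 ≤ (1 - a) * (x ^ 2 + (1 + κ) * w ^ 2 - 2 * (w * x) - a * (x ^ 2 + w ^ 2)) := by
      rw [h2]; positivity
    nlinarith [nonneg_of_mul_nonneg_right h3 h1]
  have e0 := mul_le_mul_of_nonneg_left (hq y (s * u)) (by positivity : 0 ≤ ρ ^ 2 * s ^ 2)
  have e3 := mul_le_mul_of_nonneg_left (h3 y θ) (by positivity : 0 ≤ ρ ^ 2 * s ^ 2)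
  have e4 := mul_le_mul_of_nonneg_left (h4 (s * u) θ) (by positivity : 0 ≤ ρ ^ 2 * s ^ 2)
  have hρ2 : ρ ^ 2 ≤ 1 := by nlinarith
  have q1 : ρ ^ 2 * ((K3 + K4) * (s ^ 2 * θ ^ 2)) ≤ (K3 + K4) * (s ^ 2 * θ ^ 2) :=
    mul_le_of_le_one_left (by positivity) hρ2
  have q2 : ρ ^ 2 * s ^ 2 * (p.k₁ * (1 + (1 + κ) * s ^ 2) * v ^ 2)
      ≤ p.k₁ * (1 + κ) * (ρ * (s ^ 2 * v ^ 2)) := by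
    have h1 : p.k₁ * (1 + κ) * (ρ * (s ^ 2 * v ^ 2))
      = ρ ^ 2 * s ^ 2 * (p.k₁ * (1 + κ) * (1 + s ^ 2) * v ^ 2) := by
      linear_combination (-p.k₁ * (1 + κ) * (ρ * (s ^ 2 * v ^ 2))) * hr
    have h2 : 0 ≤ ρ ^ 2 * s ^ 2 * (p.k₁ * κ * v ^ 2) := by positivity
    rw [h1]
    linarith
  have q3 : 0 ≤ (K3 + K4) * (ρ * (s ^ 2 * v ^ 2)) := by positivity
  have q4 : 0 ≤ p.k₁ * (1 + κ) * (s ^ 2 * θ ^ 2) := by positivity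
  linarith

end Mode

/-! ### Weighted multipliers and the chain of controlled components -/

namespace Mode

variable {p : Coeffs} {S : Set (Mode p)} {m : Mode p → ℝ}

/-- The conditions on a weight `m`, with which the multipliers are bounded by the energy and the
contributions of `η` by the dissipation. -/
def IsWeight (S : Set (Mode p)) (m : Mode p → ℝ) : Prop :=
  ∃ C ≥ 0, ∀ X ∈ S, 0 ≤ m X ∧ m X * (1 + X.s ^ 2 + X.D ^ 2) ≤ C * X.D ∧ m X * (1 + |X.s|) ≤ C

theorem abs_mul_le_of_sq_le {a b N : ℝ} (ha : a ^ 2 ≤ N) (hb : b ^ 2 ≤ N) : |a * b| ≤ N := by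
  rw [abs_le]
  constructor <;> nlinarith [sq_nonneg (a + b), sq_nonneg (a - b)]

/-- `A` is bounded by the norm, uniformly for all modes. -/
def QuadBounded (A : Mode p → ℝ → ℝ) : Prop :=
  ∃ a ≥ 0, ∀ X t, |A X t| ≤ a * X.normSq t

theorem quadBounded_mul {f g : Mode p → ℝ → ℝ} (hf : ∀ X t, f X t ^ 2 ≤ X.normSq t)
    (hg : ∀ X t, g X t ^ 2 ≤ X.normSq t) : QuadBounded (fun X t => f X t * g X t) :=
  ⟨1, zero_le_one, fun X t => by
    rw [one_mul]; exact abs_mul_le_of_sq_le (hf X t) (hg X t)⟩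

theorem quadBounded_zero : QuadBounded (p := p) (fun _ _ => 0) :=
  ⟨0, le_rfl, fun X t => by simp⟩

theorem QuadBounded.add {A B : Mode p → ℝ → ℝ} (hA : QuadBounded A) (hB : QuadBounded B) :
    QuadBounded (fun X t => A X t + B X t) := by
  obtain ⟨a, ha, hA⟩ := hA
  obtain ⟨b, hb, hB⟩ := hB
  refine ⟨a + b, by positivity, fun X t => (abs_add_le _ _).trans ?_⟩
  linarith [hA X t, hB X t]

theorem QuadBounded.const_mul {A : Mode p → ℝ → ℝ} (hA : QuadBounded A) (c : ℝ) :
    QuadBounded (fun X t => c * A X t) := by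
  obtain ⟨a, ha, hA⟩ := hA
  refine ⟨|c| * a, by positivity, fun X t => ?_⟩
  rw [abs_mul, mul_assoc]
  exact mul_le_mul_of_nonneg_left (hA X t) (abs_nonneg c)

section sq_le
variable (X : Mode p) (t : ℝ)

theorem v_sq_le : X.v t ^ 2 ≤ X.normSq t := by
  unfold normSq; rw [← sub_nonneg]; ring_nf; positivity

theorem u_sq_le : X.u t ^ 2 ≤ X.normSq t := by
  unfold normSq; rw [← sub_nonneg]; ring_nf; positivity

theorem z_sq_le : X.z t ^ 2 ≤ X.normSq t := by
  unfold normSq; rw [← sub_nonneg]; ring_nf; positivity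

theorem y_sq_le : X.y t ^ 2 ≤ X.normSq t := by
  unfold normSq; rw [← sub_nonneg]; ring_nf; positivity

theorem φ_sq_le : X.φ t ^ 2 ≤ X.normSq t := by
  unfold normSq; rw [← sub_nonneg]; ring_nf; positivity

theorem θ_sq_le : X.θ t ^ 2 ≤ X.normSq t := by
  unfold normSq; rw [← sub_nonneg]; ring_nf; positivity

theorem σ_sq_le : X.σ t ^ 2 ≤ X.normSq t := by
  unfold normSq; rw [← sub_nonneg]; ring_nf; positivity

theorem η_sq_le : X.η t ^ 2 ≤ X.normSq t := by
  unfold normSq; rw [← sub_nonneg]; ring_nf; positivity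

end sq_le

theorem abs_weight_mul_le {m C s w A B a b N : ℝ} (hm : 0 ≤ m) (hC : m * (1 + |s|) ≤ C)
    (hw : |w| ≤ 1) (ha : 0 ≤ a) (hb : 0 ≤ b) (hN : 0 ≤ N) (hA : |A| ≤ a * N) (hB : |B| ≤ b * N) :
    |m * (w * (s * A + B))| ≤ C * (a + b) * N := by
  have h1 : |s * A + B| ≤ (1 + |s|) * ((a + b) * N) := by
    refine (abs_add_le _ _).trans ?_
    rw [abs_mul]
    have := mul_le_mul_of_nonneg_left hA (abs_nonneg s)
    have h2 : 0 ≤ |s| * (b * N) := by positivity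
    have h3 : 0 ≤ a * N := by positivity
    nlinarith
  rw [abs_mul, abs_mul, abs_of_nonneg hm]
  calc m * (|w| * |s * A + B|) ≤ m * (1 * ((1 + |s|) * ((a + b) * N))) := by gcongr
    _ = m * (1 + |s|) * ((a + b) * N) := by ring
    _ ≤ C * ((a + b) * N) := by gcongr
    _ = _ := by ring

/-- The derivative of a weighted multiplier is controlled. -/
theorem IsWeight.controlled_deriv (hm : IsWeight S m) (w : Mode p → ℝ) (hw : ∀ X ∈ S, |w X| ≤ 1)
    {A B F' : Mode p → ℝ → ℝ} (hA : QuadBounded A) (hB : QuadBounded B)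
    (hF : ∀ X ∈ S, ∀ t, HasDerivAt (fun t => X.s * A X t + B X t) (F' X t) t) :
    Controlled S (fun X t => m X * (w X * F' X t)) := by
  obtain ⟨C, hC, hm⟩ := hm
  obtain ⟨a, ha, hA⟩ := hA
  obtain ⟨b, hb, hB⟩ := hB
  refine Mode.controlled_deriv (C * (a + b))
    (B := fun X t => m X * (w X * (X.s * A X t + B X t))) (fun X hX t => ?_) (fun X hX t => ?_)
  · exact ((hF X hX t).const_mul (w X)).const_mul (m X)
  · exact abs_weight_mul_le (hm X hX).1 (hm X hX).2.2 (hw X hX) ha hb (X.normSq_nonneg t)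
      (hA X t) (hB X t)

theorem IsWeight.controlled_damped (hm : IsWeight S m) {K : ℝ} (hK : 0 ≤ K) :
    Controlled S (fun X t => m X * (K * ((1 + X.s ^ 2 + X.D ^ 2) * X.η t ^ 2))) := by
  obtain ⟨C, hC, hm⟩ := hm
  refine (controlled_dissipation (K * C) (fun X => K * (m X * (1 + X.s ^ 2 + X.D ^ 2)))
    (fun X hX => ?_)).mono (fun X hX t => le_of_eq (by ring))
  have := mul_le_mul_of_nonneg_left (hm X hX).2.1 hK
  linarith

/-- The multiplier is `s(ση + γ(1+k₄)σφ - γηθ)`. The outer products produce `k₄s²σ²` and `γ²s²θ²`,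
and the coefficient of `σφ` is the one that cancels every `s²σθ` term. -/
theorem IsWeight.controlled_heat (hm : IsWeight S m) (hk₄ : 0 < p.k₄) (hγ : p.γ ≠ 0) :
    ∀ δ > 0, Controlled S (fun X t => m X * (X.s ^ 2 * (X.θ t ^ 2 + X.σ t ^ 2)
      - δ * (X.ρ * (X.s ^ 2 * (X.s ^ 2 * X.φ t ^ 2 + X.v t ^ 2))))) := by
  intro δ hδ
  obtain ⟨a, ha, h⟩ := exists_heat_ineq hk₄ hγ
  obtain ⟨K, hK, h⟩ := h (a * δ) (by positivity)
  have h1 := hm.controlled_deriv (fun _ => 1) (by simp)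
    ((((quadBounded_mul σ_sq_le η_sq_le).add
      ((quadBounded_mul σ_sq_le φ_sq_le).const_mul (p.γ + p.γ * p.k₄))).add
      ((quadBounded_mul η_sq_le θ_sq_le).const_mul (-p.γ)))) quadBounded_zero
    (fun X hX t => ((((X.hσ t).mul (X.hη t)).add
      (((X.hσ t).mul (X.hφ t)).const_mul (p.γ + p.γ * p.k₄))).add
      (((X.hη t).mul (X.hθ t)).const_mul (-p.γ))).const_mul X.s |>.add (hasDerivAt_const t 0))
  refine ((h1.add (hm.controlled_damped hK)).const_mul (inv_nonneg.2 ha.le)).mono fun X hX t => ?_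
  have h2 := h X.s X.D X.ρ (X.v t) (X.φ t) (X.θ t) (X.σ t) (X.η t) X.ρ_pos X.ρ_mul
  obtain ⟨C, hC, hm⟩ := hm
  have h3 := mul_le_mul_of_nonneg_left h2 (hm X hX).1
  rw [inv_mul_eq_div, le_div_iff₀ ha]
  linarith

/-- The multiplier is `sk₃θφ + k₁θv + 2k₃φu`, taken with the factor `-ρs²`. The first two products
give `φ²` and `v²` with a sign, and `2k₃φu` cancels their common cross term `-2k₁k₃s vφ`. -/
theorem IsWeight.controlled_shear (hm : IsWeight S m) (hk₁ : 0 < p.k₁) (hk₃ : 0 < p.k₃) :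
    ∀ δ > 0, ∃ K ≥ 0, Controlled S (fun X t =>
      m X * (X.ρ * (X.s ^ 2 * (X.s ^ 2 * X.φ t ^ 2 + X.v t ^ 2))
        - K * (X.s ^ 2 * (X.θ t ^ 2 + X.σ t ^ 2))
        - δ * (X.ρ ^ 2 * (X.s ^ 2 * (X.y t ^ 2 + X.s ^ 2 * X.u t ^ 2))))) := by
  intro δ hδ
  obtain ⟨a, ha, h⟩ := exists_shear_ineq hk₁ hk₃
  obtain ⟨K, hK, h⟩ := h (a * δ) (by positivity)
  have h1 := hm.controlled_deriv (fun X => -(X.ρ * X.s ^ 2))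
    (fun X _ => by
      rw [abs_neg, abs_of_nonneg (mul_nonneg X.ρ_pos.le (sq_nonneg _))]; exact X.ρ_mul_sq_le)
    ((quadBounded_mul θ_sq_le φ_sq_le).const_mul p.k₃)
    (((quadBounded_mul θ_sq_le v_sq_le).const_mul p.k₁).add
      ((quadBounded_mul φ_sq_le u_sq_le).const_mul (2 * p.k₃)))
    (fun X hX t => (((X.hθ t).mul (X.hφ t)).const_mul p.k₃).const_mul X.s |>.add
      ((((X.hθ t).mul (X.hv t)).const_mul p.k₁).add
        (((X.hφ t).mul (X.hu t)).const_mul (2 * p.k₃))))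
  refine ⟨a⁻¹ * K, by positivity,
    ((h1.add (hm.controlled_damped hK)).const_mul (inv_nonneg.2 ha.le)).mono fun X hX t => ?_⟩
  have h2 := h X.s X.ρ (X.v t) (X.u t) (X.y t) (X.φ t) (X.θ t) (X.η t) X.ρ_pos X.ρ_mul
  obtain ⟨C, hC, hm⟩ := hm
  have h3 := mul_le_mul_of_nonneg_left h2 (hm X hX).1
  have h4 : 0 ≤ m X * (K * (X.s ^ 2 * X.σ t ^ 2)) :=
    mul_nonneg (hm X hX).1 (by positivity)
  have h5 : 0 ≤ m X * (K * (X.D ^ 2 * X.η t ^ 2)) :=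
    mul_nonneg (hm X hX).1 (by positivity)
  rw [inv_mul_eq_div, inv_mul_eq_div, le_div_iff₀ ha]
  have h6 : K / a * a = K := by field_simp
  linear_combination h3 + h4 + h5 - (m X * (X.s ^ 2 * (X.θ t ^ 2 + X.σ t ^ 2))) * h6

/-- The multiplier is `-(1+κ)s vu + vy + κzu`. The choice `κ = k₂/k₁` cancels `vz` whatever the wave
speeds, and leaves `y² + (1+κ)s²u² - 2s uy`, which is definite because `κ > 0`. -/
theorem IsWeight.controlled_rotation (hm : IsWeight S m) (hk₁ : 0 < p.k₁) (hk₂ : 0 < p.k₂) :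
    ∃ K ≥ 0, Controlled S (fun X t =>
      m X * (X.ρ ^ 2 * (X.s ^ 2 * (X.y t ^ 2 + X.s ^ 2 * X.u t ^ 2))
        - K * (X.ρ * (X.s ^ 2 * (X.s ^ 2 * X.φ t ^ 2 + X.v t ^ 2))
          + X.s ^ 2 * (X.θ t ^ 2 + X.σ t ^ 2)))) := by
  set κ := p.k₂ / p.k₁ with hκ
  have hκ' : κ * p.k₁ = p.k₂ := by rw [hκ]; field_simp
  obtain ⟨a, ha, K, hK, h⟩ := exists_rotation_ineq (p := p) hk₁ (κ := κ) (by positivity)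
  have h1 := hm.controlled_deriv (fun X => X.ρ ^ 2 * X.s ^ 2)
    (fun X _ => by
      have := X.ρ_pos
      rw [abs_of_nonneg (by positivity)]
      nlinarith [X.ρ_mul_sq_le, X.ρ_le, X.ρ_pos])
    ((quadBounded_mul v_sq_le u_sq_le).const_mul (-(1 + κ)))
    ((quadBounded_mul v_sq_le y_sq_le).add ((quadBounded_mul z_sq_le u_sq_le).const_mul κ))
    (fun X hX t => (((X.hv t).mul (X.hu t)).const_mul (-(1 + κ))).const_mul X.s |>.add
      (((X.hv t).mul (X.hy t)).add (((X.hz t).mul (X.hu t)).const_mul κ)))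
  refine ⟨a⁻¹ * K, by positivity, (h1.const_mul (inv_nonneg.2 ha.le)).mono fun X hX t => ?_⟩
  have h2 := h X.s X.ρ (X.v t) (X.u t) (X.y t) (X.θ t) X.ρ_pos X.ρ_mul
  obtain ⟨C, hC, hm⟩ := hm
  have h3 := mul_le_mul_of_nonneg_left h2 (hm X hX).1
  have hρ := X.ρ_pos
  have h4 : 0 ≤ m X * (K * (X.ρ * (X.s ^ 2 * (X.s ^ 2 * X.φ t ^ 2)) + X.s ^ 2 * X.σ t ^ 2)) :=
    mul_nonneg (hm X hX).1 (by positivity)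
  rw [inv_mul_eq_div, inv_mul_eq_div, le_div_iff₀ ha]
  have h6 : K / a * a = K := by field_simp
  linear_combination h3 + h4 - (m X * (X.ρ * (X.s ^ 2 * (X.s ^ 2 * X.φ t ^ 2 + X.v t ^ 2))
    + X.s ^ 2 * (X.θ t ^ 2 + X.σ t ^ 2))) * h6
    - m X * (X.ρ ^ 2 * X.s ^ 2) * X.s * X.v t * X.z t * hκ'

/-- The part of the energy controlled without assumptions on the coefficients, but for `z`. -/
theorem IsWeight.controlled_main (hm : IsWeight S m) (hk₁ : 0 < p.k₁) (hk₂ : 0 < p.k₂)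
    (hk₃ : 0 < p.k₃) (hk₄ : 0 < p.k₄) (hγ : p.γ ≠ 0) :
    Controlled S (fun X t => m X * (X.s ^ 2 * (X.θ t ^ 2 + X.σ t ^ 2)
      + X.ρ * (X.s ^ 2 * (X.s ^ 2 * X.φ t ^ 2 + X.v t ^ 2))
      + X.ρ ^ 2 * (X.s ^ 2 * (X.y t ^ 2 + X.s ^ 2 * X.u t ^ 2)))) := by
  obtain ⟨K₃, hK₃, h3⟩ := hm.controlled_rotation hk₁ hk₂
  -- The order matters: `K₃` is free of parameters, `δ` depends on `K₃`, `K₂` on `δ`, and `ε` on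
  -- `K₂`. The sum `(K₂+2)·heat + shear + 2δ·rotation` then has coefficients at least `3/2`, `1/4`
  -- and `δ`, which `c` scales above one.
  set δ := 1 / (4 * (K₃ + 1)) with hδ
  have hδ0 : 0 < δ := by positivity
  have hδ1 : δ * (K₃ + 1) = 1 / 4 := by rw [hδ]; field_simp
  obtain ⟨K₂, hK₂, h2⟩ := hm.controlled_shear hk₁ hk₃ δ hδ0
  set ε := 1 / (4 * (K₂ + 2)) with hε
  have hε0 : 0 < ε := by positivity
  have hε1 : ε * (K₂ + 2) = 1 / 4 := by rw [hε]; field_simp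
  have h1 := hm.controlled_heat hk₄ hγ ε hε0
  set c := max 4 (1 / δ) with hc
  have hc4 : 4 ≤ c := le_max_left _ _
  have hcδ : 1 ≤ c * δ := by
    have := mul_le_mul_of_nonneg_right (le_max_right 4 (1 / δ)) hδ0.le
    rwa [one_div_mul_cancel hδ0.ne'] at this
  refine ((((h1.const_mul (by positivity : 0 ≤ K₂ + 2)).add h2).add
    (h3.const_mul (by positivity : 0 ≤ 2 * δ))).const_mul (by positivity : 0 ≤ c)).mono
    fun X hX t => ?_
  obtain ⟨C, hC, hm⟩ := hm
  have hρ := X.ρ_pos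
  have g1 : 0 ≤ m X * (X.s ^ 2 * (X.θ t ^ 2 + X.σ t ^ 2)) :=
    mul_nonneg (hm X hX).1 (by positivity)
  have g2 : 0 ≤ m X * (X.ρ * (X.s ^ 2 * (X.s ^ 2 * X.φ t ^ 2 + X.v t ^ 2))) :=
    mul_nonneg (hm X hX).1 (by positivity)
  have g3 : 0 ≤ m X * (X.ρ ^ 2 * (X.s ^ 2 * (X.y t ^ 2 + X.s ^ 2 * X.u t ^ 2))) :=
    mul_nonneg (hm X hX).1 (by positivity)
  set G1 := m X * (X.s ^ 2 * (X.θ t ^ 2 + X.σ t ^ 2))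
  set G2 := m X * (X.ρ * (X.s ^ 2 * (X.s ^ 2 * X.φ t ^ 2 + X.v t ^ 2)))
  set G3 := m X * (X.ρ ^ 2 * (X.s ^ 2 * (X.y t ^ 2 + X.s ^ 2 * X.u t ^ 2)))
  have e1 : 1 ≤ c * (2 - 2 * δ * K₃) := by nlinarith
  have e2 : 1 ≤ c * (1 - ε * (K₂ + 2) - 2 * δ * K₃) := by nlinarith
  have f1 := mul_le_mul_of_nonneg_right e1 g1
  have f2 := mul_le_mul_of_nonneg_right e2 g2
  have f3 := mul_le_mul_of_nonneg_right hcδ g3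
  calc _ = G1 + G2 + G3 := by simp only [G1, G2, G3]; ring
    _ ≤ c * (2 - 2 * δ * K₃) * G1 + c * (1 - ε * (K₂ + 2) - 2 * δ * K₃) * G2 + c * δ * G3 := by
      linarith
    _ = _ := by simp only [G1, G2, G3]; ring

end Mode

/-! ### Decay rates of the modes -/

namespace Mode

variable {p : Coeffs} {S : Set (Mode p)} {m : Mode p → ℝ}

theorem half_sq_add_sq (a b : ℝ) : a * b ≤ (a ^ 2 + b ^ 2) / 2 := by
  nlinarith [sq_nonneg (a - b)]

theorem IsWeight.nonneg (hm : IsWeight S m) {X : Mode p} (hX : X ∈ S) : 0 ≤ m X := by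
  obtain ⟨C, hC, hm⟩ := hm
  exact (hm X hX).1

/-- The functional controlling `z` by `y` and `u`. -/
theorem IsWeight.controlled_slope (hm : IsWeight S m) (w : Mode p → ℝ)
    (hw : ∀ X, 0 ≤ w X ∧ w X ≤ 1) :
    Controlled S (fun X t => m X * (w X * (p.k₂ * (X.s ^ 2 * X.z t ^ 2) - X.s ^ 2 * X.y t ^ 2
      - (X.y t ^ 2 + X.s ^ 2 * X.u t ^ 2) / 2))) := by
  -- The multiplier is `s zy + zu`; the second product cancels the `vz` term coming from `y'`.
  have h1 := hm.controlled_deriv (fun X => -w X)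
    (fun X _ => by rw [abs_neg, abs_of_nonneg (hw X).1]; exact (hw X).2)
    (quadBounded_mul z_sq_le y_sq_le) (quadBounded_mul z_sq_le u_sq_le)
    (fun X hX t => (((X.hz t).mul (X.hy t))).const_mul X.s |>.add ((X.hz t).mul (X.hu t)))
  refine h1.mono fun X hX t => ?_
  have h2 := mul_le_mul_of_nonneg_left (mul_le_mul_of_nonneg_left
    (half_sq_add_sq (X.y t) (X.s * X.u t)) (hw X).1) (hm.nonneg hX)
  linear_combination h2

/-- For `k₁ = k₂`, the functional controlling `y` by `v` and `θ`. -/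
theorem hasDerivAt_vy_add_zu (h12 : p.k₁ = p.k₂) (X : Mode p) (t : ℝ) :
    HasDerivAt (fun t => X.v t * X.y t + X.z t * X.u t)
      (X.y t ^ 2 + X.y t * X.θ t - p.k₁ * X.v t ^ 2) t :=
  (((X.hv t).mul (X.hy t)).add ((X.hz t).mul (X.hu t))).congr_deriv (by rw [← h12]; ring)

/-- For `k₁ = k₃`, the functional controlling `v` by `θ`, `y` and `η`. -/
theorem hasDerivAt_θv_add_φu (h13 : p.k₁ = p.k₃) (X : Mode p) (t : ℝ) :
    HasDerivAt (fun t => X.θ t * X.v t + X.φ t * X.u t)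
      (X.θ t ^ 2 + X.y t * X.θ t - p.k₁ * X.v t ^ 2 + X.s * p.γ * X.η t * X.v t) t :=
  (((X.hθ t).mul (X.hv t)).add ((X.hφ t).mul (X.hu t))).congr_deriv (by rw [← h13]; ring)

theorem rate_ineq {a A : ℝ} {b c v u z y φ θ σ η : ℝ} (hA : a ≤ A) (hb : a ≤ b) (hc : a ≤ c)
    {e d f g h : ℝ} (he : a ≤ e) (hd : a ≤ d) (hf : a ≤ f) (hg : a ≤ g) (hh : a ≤ h) :
    a * (v ^ 2 + u ^ 2 + z ^ 2 + y ^ 2 + φ ^ 2 + θ ^ 2 + σ ^ 2 + η ^ 2) ≤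
      A * v ^ 2 + b * u ^ 2 + c * z ^ 2 + e * y ^ 2 + d * φ ^ 2 + f * θ ^ 2 + g * σ ^ 2
        + h * η ^ 2 := by
  have := mul_le_mul_of_nonneg_right hA (sq_nonneg v)
  have := mul_le_mul_of_nonneg_right hb (sq_nonneg u)
  have := mul_le_mul_of_nonneg_right hc (sq_nonneg z)
  have := mul_le_mul_of_nonneg_right he (sq_nonneg y)
  have := mul_le_mul_of_nonneg_right hd (sq_nonneg φ)
  have := mul_le_mul_of_nonneg_right hf (sq_nonneg θ)
  have := mul_le_mul_of_nonneg_right hg (sq_nonneg σ)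
  have := mul_le_mul_of_nonneg_right hh (sq_nonneg η)
  linarith

section ρ

variable (X : Mode p)

theorem ρ_sq_le : X.ρ ^ 2 ≤ X.ρ := by
  have h0 := X.ρ_pos.le
  have h1 := mul_le_mul_of_nonneg_left X.ρ_le h0
  linarith

theorem ρ_mul_fourth_le : X.ρ * X.s ^ 4 ≤ X.s ^ 2 := by
  have := mul_le_mul_of_nonneg_right X.ρ_mul_sq_le (sq_nonneg X.s)
  linarith

theorem ρ_sq_mul_fourth_le : X.ρ ^ 2 * X.s ^ 4 ≤ X.ρ * X.s ^ 2 := by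
  have := mul_le_mul_of_nonneg_left X.ρ_mul_fourth_le X.ρ_pos.le
  linarith

theorem ρ_cube_mul_fourth_le : X.ρ ^ 3 * X.s ^ 4 ≤ X.ρ ^ 2 * X.s ^ 2 := by
  have := mul_le_mul_of_nonneg_left X.ρ_sq_mul_fourth_le X.ρ_pos.le
  linarith

theorem ρ_sq_mul_sq_le : X.ρ ^ 2 * X.s ^ 2 ≤ X.ρ * X.s ^ 2 :=
  mul_le_mul_of_nonneg_right X.ρ_sq_le (sq_nonneg _)

theorem ρ_mul_sq_le_sq : X.ρ * X.s ^ 2 ≤ X.s ^ 2 :=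
  mul_le_of_le_one_left (sq_nonneg _) X.ρ_le

end ρ

/-- Decay without assumptions on the wave speeds. -/
theorem IsWeight.decay (hm : IsWeight S m) (hk₁ : 0 < p.k₁) (hk₂ : 0 < p.k₂)
    (hk₃ : 0 < p.k₃) (hk₄ : 0 < p.k₄) (hγ : p.γ ≠ 0) :
    ∃ C > 0, ∃ c > 0, ∀ X ∈ S, ∀ t, 0 ≤ t →
      X.normSq t ≤ C * Real.exp (-c * (m X * (X.ρ ^ 3 * X.s ^ 4)) * t) * X.normSq 0 := by
  have h1 := hm.controlled_main hk₁ hk₂ hk₃ hk₄ hγ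
  -- The factor is chosen so that the loss `ρ³s⁴y²` is at most `ρ²s²y²`, which is already
  -- controlled. Then `z` is the worst component and fixes the rate.
  have h2 := hm.controlled_slope (fun X => X.ρ ^ 3 * X.s ^ 2) (fun X => ⟨by
    have := X.ρ_pos; positivity, by
    have := X.ρ_sq_mul_sq_le
    have := X.ρ_mul_sq_le
    have := mul_le_mul_of_nonneg_left X.ρ_sq_mul_sq_le X.ρ_pos.le
    linarith⟩)
  have h3 := hm.controlled_damped zero_le_one
  refine (((h1.const_mul (by norm_num : (0 : ℝ) ≤ 3)).add
    ((h2.const_mul (inv_nonneg.2 hk₂.le)).add (h1.const_mul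
      (by positivity : 0 ≤ 2 * p.k₂⁻¹)))).add h3).decay hk₁ hk₂ hk₃ hk₄
    (fun X hX => mul_nonneg (hm.nonneg hX) (by have := X.ρ_pos; positivity)) fun X hX t => ?_
  have hρ := X.ρ_pos
  have i1 := X.ρ_cube_mul_fourth_le
  have i2 := X.ρ_sq_mul_sq_le
  have i3 := X.ρ_mul_sq_le_sq
  have i4 := X.ρ_mul_sq_le
  have i5 := mul_le_mul_of_nonneg_left i2 hρ.le
  have i6 : X.ρ ^ 3 * X.s ^ 4 ≤ X.ρ ^ 2 * X.s ^ 4 := by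
    have := mul_le_mul_of_nonneg_left X.ρ_le (by positivity : 0 ≤ X.ρ ^ 2 * X.s ^ 4)
    linarith
  have i7 := X.ρ_sq_mul_fourth_le
  have i8 := X.ρ_mul_fourth_le
  have j := rate_ineq (v := X.v t) (u := X.u t) (z := X.z t) (y := X.y t) (φ := X.φ t)
    (θ := X.θ t) (σ := X.σ t) (η := X.η t) (a := X.ρ ^ 3 * X.s ^ 4) (A := X.ρ * X.s ^ 2)
    (b := X.ρ ^ 2 * X.s ^ 4) (c := X.ρ ^ 3 * X.s ^ 4) (e := X.ρ ^ 2 * X.s ^ 2)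
    (d := X.ρ * X.s ^ 4) (f := X.s ^ 2) (g := X.s ^ 2) (h := 1) (by linarith) (by linarith) le_rfl
    (by linarith) (by
      have := mul_le_mul_of_nonneg_right X.ρ_sq_le (by positivity : 0 ≤ X.s ^ 4)
      linarith) (by linarith) (by linarith) (by linarith)
  have j1 := mul_le_mul_of_nonneg_left j (hm.nonneg hX)
  have j2 : 0 ≤ m X * ((X.s ^ 2 + X.D ^ 2) * X.η t ^ 2) :=
    mul_nonneg (hm.nonneg hX) (by positivity)
  have j3 : 0 ≤ 2 * (m X * (X.s ^ 2 * (X.θ t ^ 2 + X.σ t ^ 2)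
      + X.ρ * (X.s ^ 2 * (X.s ^ 2 * X.φ t ^ 2 + X.v t ^ 2))
      + X.ρ ^ 2 * (X.s ^ 2 * (X.y t ^ 2 + X.s ^ 2 * X.u t ^ 2)))) :=
    mul_nonneg zero_le_two (mul_nonneg (hm.nonneg hX) (by positivity))
  have j4 : X.ρ ^ 3 * X.s ^ 2 * (X.s ^ 2 * X.y t ^ 2 + (X.y t ^ 2 + X.s ^ 2 * X.u t ^ 2) / 2) ≤
      2 * (X.s ^ 2 * (X.θ t ^ 2 + X.σ t ^ 2)
      + X.ρ * (X.s ^ 2 * (X.s ^ 2 * X.φ t ^ 2 + X.v t ^ 2))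
      + X.ρ ^ 2 * (X.s ^ 2 * (X.y t ^ 2 + X.s ^ 2 * X.u t ^ 2))) := by
    have k1 := mul_le_mul_of_nonneg_right i1 (sq_nonneg (X.y t))
    have k2 := mul_le_mul_of_nonneg_right X.ρ_le
      (by positivity : 0 ≤ X.ρ ^ 2 * (X.s ^ 2 * (X.y t ^ 2 + X.s ^ 2 * X.u t ^ 2)))
    have k3 : 0 ≤ X.s ^ 2 * (X.θ t ^ 2 + X.σ t ^ 2)
      + X.ρ * (X.s ^ 2 * (X.s ^ 2 * X.φ t ^ 2 + X.v t ^ 2)) := by positivity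
    have k4 : 0 ≤ X.ρ ^ 2 * (X.s ^ 2 * (X.y t ^ 2 + X.s ^ 2 * X.u t ^ 2)) := by positivity
    have k5 : 0 ≤ X.ρ ^ 2 * (X.s ^ 2 * (X.s ^ 2 * X.u t ^ 2)) := by positivity
    linarith
  have j5 := mul_le_mul_of_nonneg_left (mul_le_mul_of_nonneg_left j4 (hm.nonneg hX))
    (inv_nonneg.2 hk₂.le)
  have hk : p.k₂⁻¹ * p.k₂ = 1 := inv_mul_cancel₀ hk₂.ne'
  unfold normSq
  linear_combination j1 + j2 + j3 + j5 - m X * (X.ρ ^ 3 * X.s ^ 4 * X.z t ^ 2) * hk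

end Mode

namespace Mode

variable {p : Coeffs} {S : Set (Mode p)} {m : Mode p → ℝ}

/-- Decay for `k₁ = k₂`, with a better rate at high frequencies. -/
theorem IsWeight.decay_of_eq (hm : IsWeight S m) (hk₁ : 0 < p.k₁) (hk₂ : 0 < p.k₂)
    (hk₃ : 0 < p.k₃) (hk₄ : 0 < p.k₄) (hγ : p.γ ≠ 0) (h12 : p.k₁ = p.k₂) :
    ∃ C > 0, ∃ c > 0, ∀ X ∈ S, ∀ t, 0 ≤ t →
      X.normSq t ≤ C * Real.exp (-c * (m X * (X.ρ ^ 2 * X.s ^ 4)) * t) * X.normSq 0 := by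
  have h1 := hm.controlled_main hk₁ hk₂ hk₃ hk₄ hγ
  have hy : Controlled S (fun X t => m X * (X.ρ * X.s ^ 2 * X.y t ^ 2)) := by
    -- For `k₁ = k₂` the errors are only `v²` and `yθ`, so `y²` is gained with `ρs²` instead of
    -- `ρ²s²`. This allows the larger factor `ρ²s²` in the control of `z` below.
    have h2 := hm.controlled_deriv (fun X => X.ρ * X.s ^ 2) (fun X _ => by
      rw [abs_of_nonneg (mul_nonneg X.ρ_pos.le (sq_nonneg _))]; exact X.ρ_mul_sq_le)
      quadBounded_zero ((quadBounded_mul v_sq_le y_sq_le).add (quadBounded_mul z_sq_le u_sq_le))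
      (fun X hX t => ((hasDerivAt_const t (0 : ℝ)).const_mul X.s).add
        (hasDerivAt_vy_add_zu h12 X t))
    refine ((h2.const_mul zero_le_two).add
      (h1.const_mul (by positivity : 0 ≤ 2 * p.k₁ + 1))).mono fun X hX t => ?_
    have hρ := X.ρ_pos
    have i1 := mul_le_mul_of_nonneg_right X.ρ_mul_sq_le_sq (sq_nonneg (X.θ t))
    have i2 := mul_nonneg (mul_nonneg hρ.le (sq_nonneg X.s)) (sq_nonneg (X.y t + X.θ t))
    have i3 : 0 ≤ (2 * p.k₁ + 1) * (X.s ^ 2 * X.σ t ^ 2 + X.ρ * (X.s ^ 2 * (X.s ^ 2 * X.φ t ^ 2))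
      + X.ρ ^ 2 * (X.s ^ 2 * (X.y t ^ 2 + X.s ^ 2 * X.u t ^ 2))) := by positivity
    have i4 : 0 ≤ 2 * p.k₁ * (X.s ^ 2 * X.θ t ^ 2) + X.ρ * X.s ^ 2 * X.v t ^ 2 := by positivity
    have i5 := mul_le_mul_of_nonneg_left (by linarith : X.ρ * X.s ^ 2 * X.y t ^ 2 ≤
      2 * (X.ρ * X.s ^ 2 * (X.y t ^ 2 + X.y t * X.θ t - p.k₁ * X.v t ^ 2)) + (2 * p.k₁ + 1) *
      (X.s ^ 2 * (X.θ t ^ 2 + X.σ t ^ 2) + X.ρ * (X.s ^ 2 * (X.s ^ 2 * X.φ t ^ 2 + X.v t ^ 2))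
      + X.ρ ^ 2 * (X.s ^ 2 * (X.y t ^ 2 + X.s ^ 2 * X.u t ^ 2)))) (hm.nonneg hX)
    linear_combination i5
  have h2 := hm.controlled_slope (fun X => X.ρ ^ 2 * X.s ^ 2) (fun X => ⟨by
    have := X.ρ_pos; positivity, by
    have := X.ρ_sq_mul_sq_le
    have := X.ρ_mul_sq_le
    linarith⟩)
  have h3 := hm.controlled_damped zero_le_one
  refine (((h1.add ((h2.add (h1.add hy)).const_mul (inv_nonneg.2 hk₂.le))).add h3).add hy).decay
    hk₁ hk₂ hk₃ hk₄
    (fun X hX => mul_nonneg (hm.nonneg hX) (by have := X.ρ_pos; positivity)) fun X hX t => ?_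
  have hρ := X.ρ_pos
  have i2 := X.ρ_sq_mul_sq_le
  have i3 := X.ρ_mul_sq_le_sq
  have i4 := X.ρ_mul_sq_le
  have i7 := X.ρ_sq_mul_fourth_le
  have i8 := X.ρ_mul_fourth_le
  have j := rate_ineq (v := X.v t) (u := X.u t) (z := X.z t) (y := X.y t) (φ := X.φ t)
    (θ := X.θ t) (σ := X.σ t) (η := X.η t) (a := X.ρ ^ 2 * X.s ^ 4) (A := X.ρ * X.s ^ 2)
    (b := X.ρ ^ 2 * X.s ^ 4) (c := X.ρ ^ 2 * X.s ^ 4) (e := X.ρ * X.s ^ 2)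
    (d := X.ρ * X.s ^ 4) (f := X.s ^ 2) (g := X.s ^ 2) (h := 1) (by linarith) le_rfl le_rfl
    (by linarith) (by
      have := mul_le_mul_of_nonneg_right X.ρ_sq_le (by positivity : 0 ≤ X.s ^ 4)
      linarith) (by linarith) (by linarith) (by linarith)
  have j1 := mul_le_mul_of_nonneg_left j (hm.nonneg hX)
  have j2 : 0 ≤ m X * ((X.s ^ 2 + X.D ^ 2) * X.η t ^ 2) :=
    mul_nonneg (hm.nonneg hX) (by positivity)
  have j4 : X.ρ ^ 2 * X.s ^ 2 * (X.s ^ 2 * X.y t ^ 2 + (X.y t ^ 2 + X.s ^ 2 * X.u t ^ 2) / 2) ≤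
      (X.s ^ 2 * (X.θ t ^ 2 + X.σ t ^ 2)
      + X.ρ * (X.s ^ 2 * (X.s ^ 2 * X.φ t ^ 2 + X.v t ^ 2))
      + X.ρ ^ 2 * (X.s ^ 2 * (X.y t ^ 2 + X.s ^ 2 * X.u t ^ 2))) + X.ρ * X.s ^ 2 * X.y t ^ 2 := by
    have k1 := mul_le_mul_of_nonneg_right i7 (sq_nonneg (X.y t))
    have k3 : 0 ≤ X.s ^ 2 * (X.θ t ^ 2 + X.σ t ^ 2)
      + X.ρ * (X.s ^ 2 * (X.s ^ 2 * X.φ t ^ 2 + X.v t ^ 2)) := by positivity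
    have k4 : 0 ≤ X.ρ ^ 2 * (X.s ^ 2 * (X.y t ^ 2 + X.s ^ 2 * X.u t ^ 2)) := by positivity
    linarith
  have j5 := mul_le_mul_of_nonneg_left (mul_le_mul_of_nonneg_left j4 (hm.nonneg hX))
    (inv_nonneg.2 hk₂.le)
  have hk : p.k₂⁻¹ * p.k₂ = 1 := inv_mul_cancel₀ hk₂.ne'
  have j6 : 0 ≤ m X * (X.ρ ^ 2 * (X.s ^ 2 * X.y t ^ 2)) :=
    mul_nonneg (hm.nonneg hX) (by positivity)
  unfold normSq
  linear_combination j1 + j2 + j5 + j6 - m X * (X.ρ ^ 2 * X.s ^ 4 * X.z t ^ 2) * hk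

/-- The modes for the dissipation `-k₅ q_{xxt}`. -/
def higherOrderModes (p : Coeffs) : Set (Mode p) := {X | X.D = p.k₅ * X.s ^ 2}

/-- The modes for the dissipation `k₅ q_t`. -/
def lowerOrderModes (p : Coeffs) : Set (Mode p) := {X | X.D = p.k₅}

theorem ρ_mul_one_add_abs_le (X : Mode p) : X.ρ * (1 + |X.s|) ≤ 2 := by
  have h1 : 1 + |X.s| ≤ 2 * (1 + X.s ^ 2) := by
    nlinarith [sq_abs X.s, sq_nonneg (|X.s| - 1)]
  have := mul_le_mul_of_nonneg_left h1 X.ρ_pos.le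
  linarith [X.ρ_mul]

/-- Up to constants, the largest weight allowed by `m(1 + s² + D²) ≤ C D` when `D` is constant. -/
theorem isWeight_lowerOrder (hk₅ : 0 < p.k₅) : IsWeight (lowerOrderModes p) (fun X => X.ρ) := by
  refine ⟨2 + (1 + p.k₅ ^ 2) / p.k₅, by positivity, fun X hX => ⟨X.ρ_pos.le, ?_, ?_⟩⟩
  · rw [hX, add_mul, div_mul_cancel₀ _ hk₅.ne']
    have := mul_le_mul_of_nonneg_right X.ρ_le (sq_nonneg p.k₅)
    linarith [X.ρ_mul]
  · have := X.ρ_mul_one_add_abs_le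
    have : 0 ≤ (1 + p.k₅ ^ 2) / p.k₅ := by positivity
    linarith

/-- The same balance with `D` proportional to `s²`: the weight degenerates like `s²` at low and like
`s⁻²` at high frequencies. -/
theorem isWeight_higherOrder (hk₅ : 0 < p.k₅) :
    IsWeight (higherOrderModes p) (fun X => X.ρ ^ 2 * X.s ^ 2) := by
  refine ⟨2 + (1 + p.k₅ ^ 2) / p.k₅, by positivity, fun X hX => ⟨by positivity, ?_, ?_⟩⟩
  · have h1 := mul_le_mul_of_nonneg_left X.ρ_sq_mul_fourth_le
      (by positivity : 0 ≤ p.k₅ ^ 2 * X.s ^ 2)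
    have h2 := mul_le_mul_of_nonneg_left X.ρ_mul_sq_le (by positivity : 0 ≤ p.k₅ ^ 2 * X.s ^ 2)
    have h3 := mul_le_mul_of_nonneg_right X.ρ_le (sq_nonneg X.s)
    have h4 : X.ρ ^ 2 * X.s ^ 2 * (1 + X.s ^ 2) = X.ρ * X.s ^ 2 := by
      linear_combination X.ρ * X.s ^ 2 * X.ρ_mul
    have h5 : (1 + p.k₅ ^ 2) / p.k₅ * (p.k₅ * X.s ^ 2) = (1 + p.k₅ ^ 2) * X.s ^ 2 := by field_simp
    have h6 : 0 ≤ p.k₅ * X.s ^ 2 := by positivity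
    rw [show X.D = p.k₅ * X.s ^ 2 from hX, add_mul, h5]
    linarith
  · have h1 := X.ρ_mul_one_add_abs_le
    have h2 : 0 ≤ (1 + p.k₅ ^ 2) / p.k₅ := by positivity
    have h3 : X.ρ ^ 2 * X.s ^ 2 ≤ X.ρ := by
      have := mul_le_mul_of_nonneg_left X.ρ_mul_sq_le X.ρ_pos.le
      linarith
    have h4 := mul_le_mul_of_nonneg_right h3 (by positivity : 0 ≤ 1 + |X.s|)
    linarith

/-- Decay for `k₁ = k₂ = k₃` and the dissipation `-k₅ q_{xxt}`. -/
theorem higherOrder_decay_of_eq (hk₁ : 0 < p.k₁) (hk₂ : 0 < p.k₂)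
    (hk₃ : 0 < p.k₃) (hk₄ : 0 < p.k₄) (hk₅ : 0 < p.k₅) (hγ : p.γ ≠ 0)
    (h12 : p.k₁ = p.k₂) (h13 : p.k₁ = p.k₃) :
    ∃ C > 0, ∃ c > 0, ∀ X ∈ higherOrderModes p, ∀ t, 0 ≤ t →
      X.normSq t ≤ C * Real.exp (-c * (X.ρ ^ 2 * X.s ^ 2 * (X.ρ * X.s ^ 4)) * t)
        * X.normSq 0 := by
  set S := higherOrderModes p
  have hm := isWeight_higherOrder hk₅
  have h1 := hm.controlled_main hk₁ hk₂ hk₃ hk₄ hγ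
  have hvy : Controlled S (fun X t => X.ρ ^ 2 * X.s ^ 4 * (X.y t ^ 2 + X.v t ^ 2)) := by
    obtain ⟨a, ha, hA⟩ := (quadBounded_mul v_sq_le y_sq_le).add
      (quadBounded_mul (p := p) z_sq_le u_sq_le)
    obtain ⟨b, hb, hB⟩ := (quadBounded_mul θ_sq_le v_sq_le).add
      (quadBounded_mul (p := p) φ_sq_le u_sq_le)
    -- The combination with factor `-2` has derivative `y² - yθ + k₁v² - 2θ² - 2γs ηv`, with both
    -- `y²` and `v²` positive. These multipliers contain no `s`, so the factor `ρ²s⁴ ≤ 1` is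
    -- admissible; unlike `m`, it does not vanish at high frequencies. The `ηv` term costs `s²η²`,
    -- exactly the damping.
    have h2 : Controlled S (fun X t => X.ρ ^ 2 * X.s ^ 4 *
        ((X.y t ^ 2 + X.y t * X.θ t - p.k₁ * X.v t ^ 2) + (-2) *
          (X.θ t ^ 2 + X.y t * X.θ t - p.k₁ * X.v t ^ 2 + X.s * p.γ * X.η t * X.v t))) := by
      refine controlled_deriv (a + 2 * b) (fun X _ t => ((hasDerivAt_vy_add_zu h12 X t).add
        ((hasDerivAt_θv_add_φu h13 X t).const_mul (-2))).const_mul _) fun X _ t => ?_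
      have hw : X.ρ ^ 2 * X.s ^ 4 ≤ 1 := X.ρ_sq_mul_fourth_le.trans X.ρ_mul_sq_le
      rw [abs_mul, abs_of_nonneg (by positivity : 0 ≤ X.ρ ^ 2 * X.s ^ 4)]
      refine (mul_le_of_le_one_left (abs_nonneg _) hw).trans ((abs_add_le _ _).trans ?_)
      rw [abs_mul (-2)]
      have := hA X t
      have := hB X t
      norm_num
      linarith
    obtain ⟨K, hK, hy⟩ := exists_young (2 * p.γ) (ε := p.k₁ / 2) (by positivity)
    have h3 : Controlled S (fun X t => (K * X.s ^ 2) * X.η t ^ 2) := by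
      refine controlled_dissipation (K / p.k₅) (fun X => K * X.s ^ 2) fun X hX => le_of_eq ?_
      rw [show X.D = p.k₅ * X.s ^ 2 from hX]
      field_simp
    refine (((h2.add h3).add (h1.const_mul (by norm_num : (0 : ℝ) ≤ 3))).const_mul
      (by positivity : 0 ≤ 2 + 2 / p.k₁)).mono fun X hX t => ?_
    have hρ := X.ρ_pos
    have hW : 0 ≤ X.ρ ^ 2 * X.s ^ 4 := by positivity
    have hw : X.ρ ^ 2 * X.s ^ 4 ≤ 1 := X.ρ_sq_mul_fourth_le.trans X.ρ_mul_sq_le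
    have i1 := mul_le_mul_of_nonneg_left (hy (X.v t) (X.s * X.η t)) hW
    have i2 := mul_le_mul_of_nonneg_right hw (by positivity : 0 ≤ K * (X.s * X.η t) ^ 2)
    have i3 := mul_le_mul_of_nonneg_left (half_sq_add_sq (X.y t) (X.θ t)) hW
    have i4 : 0 ≤ 3 * (X.ρ ^ 2 * X.s ^ 2 * (X.s ^ 2 * X.σ t ^ 2
      + X.ρ * (X.s ^ 2 * (X.s ^ 2 * X.φ t ^ 2 + X.v t ^ 2))
      + X.ρ ^ 2 * (X.s ^ 2 * (X.y t ^ 2 + X.s ^ 2 * X.u t ^ 2))))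
      + X.ρ ^ 2 * X.s ^ 4 * (X.θ t ^ 2) / 2 := by positivity
    have i5 : X.ρ ^ 2 * X.s ^ 4 * (X.y t ^ 2 / 2 + p.k₁ / 2 * X.v t ^ 2) ≤
      X.ρ ^ 2 * X.s ^ 4 *
        ((X.y t ^ 2 + X.y t * X.θ t - p.k₁ * X.v t ^ 2) + (-2) *
          (X.θ t ^ 2 + X.y t * X.θ t - p.k₁ * X.v t ^ 2 + X.s * p.γ * X.η t * X.v t))
      + (K * X.s ^ 2) * X.η t ^ 2 + 3 * (X.ρ ^ 2 * X.s ^ 2 * (X.s ^ 2 * (X.θ t ^ 2 + X.σ t ^ 2)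
      + X.ρ * (X.s ^ 2 * (X.s ^ 2 * X.φ t ^ 2 + X.v t ^ 2))
      + X.ρ ^ 2 * (X.s ^ 2 * (X.y t ^ 2 + X.s ^ 2 * X.u t ^ 2)))) := by
      linarith
    have i6 := mul_le_mul_of_nonneg_left i5 (by positivity : 0 ≤ 2 + 2 / p.k₁)
    refine le_trans ?_ i6
    have i7 : (2 + 2 / p.k₁) * (X.ρ ^ 2 * X.s ^ 4 * (X.y t ^ 2 / 2 + p.k₁ / 2 * X.v t ^ 2))
      = X.ρ ^ 2 * X.s ^ 4 * (X.y t ^ 2 + X.v t ^ 2) + X.ρ ^ 2 * X.s ^ 4 *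
        (X.y t ^ 2 / p.k₁ + p.k₁ * X.v t ^ 2) := by field_simp; ring
    have i8 : 0 ≤ X.ρ ^ 2 * X.s ^ 4 * (X.y t ^ 2 / p.k₁ + p.k₁ * X.v t ^ 2) := by positivity
    linarith
  have hu : Controlled S (fun X t => X.ρ ^ 3 * X.s ^ 6 * X.u t ^ 2) := by
    -- The derivative of `-s vu` is `s²u² - s uy - s uθ - k₁s²v²`; the improved bounds on `v` and
    -- `y` now absorb the errors.
    have h2 := hm.controlled_deriv (fun X => -(X.ρ * X.s ^ 2)) (fun X _ => by
      rw [abs_neg, abs_of_nonneg (mul_nonneg X.ρ_pos.le (sq_nonneg _))]; exact X.ρ_mul_sq_le)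
      (quadBounded_mul v_sq_le u_sq_le) quadBounded_zero
      (fun X hX t => (((X.hv t).mul (X.hu t)).const_mul X.s).add (hasDerivAt_const t (0 : ℝ)))
    refine (((h2.const_mul zero_le_two).add (hvy.const_mul
      (by positivity : 0 ≤ 2 * p.k₁ + 2))).add (h1.const_mul zero_le_two)).mono fun X hX t => ?_
    have hρ := X.ρ_pos
    have hW : 0 ≤ X.ρ ^ 3 * X.s ^ 4 := by positivity
    have i1 := mul_nonneg hW (sq_nonneg (X.s * X.u t - 2 * X.y t))
    have i1' := mul_nonneg hW (sq_nonneg (X.s * X.u t - 2 * X.θ t))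
    have i2 := mul_le_mul_of_nonneg_right X.ρ_le
      (by positivity : 0 ≤ X.ρ ^ 2 * X.s ^ 4 * X.y t ^ 2)
    have i3 := mul_le_mul_of_nonneg_right X.ρ_le
      (by positivity : 0 ≤ X.ρ ^ 2 * X.s ^ 4 * X.θ t ^ 2)
    have i4 := mul_le_mul_of_nonneg_left X.ρ_mul_sq_le
      (by positivity : 0 ≤ 2 * p.k₁ * (X.ρ ^ 2 * X.s ^ 4 * X.v t ^ 2))
    have i5 : 0 ≤ 2 * (X.ρ ^ 2 * X.s ^ 2 * (X.s ^ 2 * X.σ t ^ 2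
      + X.ρ * (X.s ^ 2 * (X.s ^ 2 * X.φ t ^ 2 + X.v t ^ 2))
      + X.ρ ^ 2 * (X.s ^ 2 * (X.y t ^ 2 + X.s ^ 2 * X.u t ^ 2)))) := by positivity
    have i6 : 0 ≤ X.ρ ^ 2 * X.s ^ 4 * (2 * p.k₁ * X.y t ^ 2 + 2 * X.v t ^ 2) := by positivity
    linarith
  have hz : Controlled S (fun X t => X.ρ ^ 3 * X.s ^ 6 * X.z t ^ 2) := by
    have h2 := hm.controlled_slope (fun X => X.ρ * X.s ^ 2)
      (fun X => ⟨mul_nonneg X.ρ_pos.le (sq_nonneg _), X.ρ_mul_sq_le⟩)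
    refine (((h2.add hu).add (hvy.const_mul zero_le_two)).const_mul
      (inv_nonneg.2 hk₂.le)).mono fun X hX t => ?_
    have hρ := X.ρ_pos
    have hk : p.k₂⁻¹ * p.k₂ = 1 := inv_mul_cancel₀ hk₂.ne'
    have i1 := mul_le_mul_of_nonneg_left X.ρ_mul_sq_le
      (by positivity : 0 ≤ X.ρ ^ 2 * X.s ^ 4 * X.y t ^ 2)
    have i2 := mul_le_mul_of_nonneg_right X.ρ_le
      (by positivity : 0 ≤ X.ρ ^ 2 * X.s ^ 4 * X.y t ^ 2)
    have i3 : 0 ≤ X.ρ ^ 3 * X.s ^ 6 * X.u t ^ 2 := by positivity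
    have i3' : 0 ≤ X.ρ ^ 2 * X.s ^ 4 * X.v t ^ 2 := by positivity
    have i4 : X.ρ ^ 3 * X.s ^ 4 * (X.s ^ 2 * X.y t ^ 2 + (X.y t ^ 2 + X.s ^ 2 * X.u t ^ 2) / 2) ≤
        X.ρ ^ 3 * X.s ^ 6 * X.u t ^ 2 + 2 * (X.ρ ^ 2 * X.s ^ 4 * (X.y t ^ 2 + X.v t ^ 2)) := by
      have : 0 ≤ X.ρ ^ 2 * X.s ^ 4 * X.y t ^ 2 := by positivity
      linarith
    have i5 := mul_le_mul_of_nonneg_left i4 (inv_nonneg.2 hk₂.le)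
    linear_combination i5 - X.ρ ^ 3 * X.s ^ 6 * X.z t ^ 2 * hk
  have h3 := hm.controlled_damped zero_le_one
  refine ((((h1.add hvy).add hu).add hz).add h3).decay hk₁ hk₂ hk₃ hk₄
    (fun X hX => by have := X.ρ_pos; positivity) fun X hX t => ?_
  have hρ := X.ρ_pos
  have i1 : X.ρ ^ 3 * X.s ^ 6 ≤ X.ρ ^ 2 * X.s ^ 4 := by
    have := mul_le_mul_of_nonneg_left X.ρ_mul_sq_le (by positivity : 0 ≤ X.ρ ^ 2 * X.s ^ 4)
    linarith
  have i2 : X.ρ ^ 3 * X.s ^ 6 ≤ X.ρ ^ 2 * X.s ^ 2 * (1 + X.s ^ 2 + X.D ^ 2) := by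
    have : 0 ≤ X.ρ ^ 2 * X.s ^ 2 * (1 + X.D ^ 2) := by positivity
    linarith
  have j := rate_ineq (v := X.v t) (u := X.u t) (z := X.z t) (y := X.y t) (φ := X.φ t)
    (θ := X.θ t) (σ := X.σ t) (η := X.η t) i1 le_rfl le_rfl i1 le_rfl i1 i1 i2
  have j2 : 0 ≤ X.ρ ^ 3 * X.s ^ 4 * X.v t ^ 2
      + X.ρ ^ 4 * X.s ^ 4 * (X.y t ^ 2 + X.s ^ 2 * X.u t ^ 2) := by positivity
  unfold normSq
  linear_combination j + j2

end Mode

/-! ### The symbol and its exponential -/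

/-- The matrix of the system in Fourier variables is `-(ζ² A₂ + ζ A₁ + A₀)` with `ζ = 2πiξ`. -/
noncomputable def symbolMatrix (d : Dissipation) (p : Coeffs) (ζ : ℂ) : Matrix (Fin 8) (Fin 8) ℂ :=
  -(ζ ^ 2 • A₂ d p + ζ • A₁ p + A₀ d p)

/-- The symbol of the system. -/
noncomputable def symbol (d : Dissipation) (p : Coeffs) (ξ : ℝ) : Vec →L[ℂ] Vec :=
  Matrix.toEuclideanCLM (𝕜 := ℂ) (n := Fin 8)
    (symbolMatrix d p ((2 * Real.pi * ξ : ℝ) * Complex.I))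

/-- The damping coefficient at the frequency `s`. -/
noncomputable def damping (d : Dissipation) (p : Coeffs) (s : ℝ) : ℝ :=
  match d with
  | .higherOrder => p.k₅ * s ^ 2
  | .lowerOrder => p.k₅

theorem symbol_apply {d : Dissipation} {p : Coeffs} (h₁ : p.τ₁ = 0) (h₂ : p.τ₂ = 0)
    (h₃ : p.τ₃ = 1) (ξ : ℝ) (x : Vec) :
    symbol d p ξ x 0 = (2 * Real.pi * ξ : ℝ) * Complex.I * x 1 + x 3 + x 5 ∧
    symbol d p ξ x 1 = (2 * Real.pi * ξ : ℝ) * Complex.I * (p.k₁ * x 0) ∧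
    symbol d p ξ x 2 = (2 * Real.pi * ξ : ℝ) * Complex.I * x 3 ∧
    symbol d p ξ x 3 = (2 * Real.pi * ξ : ℝ) * Complex.I * (p.k₂ * x 2) - p.k₁ * x 0 ∧
    symbol d p ξ x 4 = (2 * Real.pi * ξ : ℝ) * Complex.I * x 5 ∧
    symbol d p ξ x 5 = (2 * Real.pi * ξ : ℝ) * Complex.I * (p.k₃ * x 4 - p.γ * x 7)
      - p.k₁ * x 0 ∧
    symbol d p ξ x 6 = (2 * Real.pi * ξ : ℝ) * Complex.I * x 7 ∧
    symbol d p ξ x 7 = (2 * Real.pi * ξ : ℝ) * Complex.I * (p.k₄ * x 6 - p.γ * x 5)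
      - damping d p (2 * Real.pi * ξ) * x 7 := by
  refine ⟨?_, ?_, ?_, ?_, ?_, ?_, ?_, ?_⟩
  all_goals
    simp only [symbol, Matrix.ofLp_toEuclideanCLM, symbolMatrix, Matrix.mulVec, dotProduct,
      Fin.sum_univ_eight, A₂, A₁, A₀, h₁, h₂, h₃, Matrix.neg_apply, Matrix.add_apply,
      Matrix.smul_apply, Matrix.of_apply, Matrix.cons_val, smul_eq_mul]
  all_goals first | (push_cast; ring1) | skip
  cases d
  · simp only [Dissipation.eps, damping]
    push_cast
    ring_nf
    simp only [Complex.I_sq]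
    ring
  · simp only [Dissipation.eps, damping]
    push_cast
    ring

theorem hasDerivAt_re {f : ℝ → ℂ} {f' : ℂ} {t : ℝ} (h : HasDerivAt f f' t) :
    HasDerivAt (fun t => (f t).re) f'.re t :=
  Complex.reCLM.hasFDerivAt.comp_hasDerivAt t h

theorem hasDerivAt_im {f : ℝ → ℂ} {f' : ℂ} {t : ℝ} (h : HasDerivAt f f' t) :
    HasDerivAt (fun t => (f t).im) f'.im t :=
  Complex.imCLM.hasFDerivAt.comp_hasDerivAt t h

theorem damping_nonneg (d : Dissipation) {p : Coeffs} (hk₅ : 0 < p.k₅) (s : ℝ) :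
    0 ≤ damping d p s := by
  cases d <;> simp only [damping] <;> positivity

/-- The real and imaginary parts of a solution at a fixed frequency. -/
theorem exists_modes {d : Dissipation} {p : Coeffs} (h₁ : p.τ₁ = 0) (h₂ : p.τ₂ = 0)
    (h₃ : p.τ₃ = 1) (hk₅ : 0 < p.k₅) (ξ : ℝ) {x : ℝ → Vec}
    (hx : ∀ t, HasDerivAt x (symbol d p ξ (x t)) t) :
    ∃ X Y : Mode p, X.s = 2 * Real.pi * ξ ∧ Y.s = 2 * Real.pi * ξ ∧
      X.D = damping d p (2 * Real.pi * ξ) ∧ Y.D = damping d p (2 * Real.pi * ξ) ∧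
      ∀ t, ‖x t‖ ^ 2 = X.normSq t + Y.normSq t := by
  have hc : ∀ i t, HasDerivAt (fun t => x t i) (symbol d p ξ (x t) i) t := fun i t =>
    ((EuclideanSpace.proj i : Vec →L[ℂ] ℂ).restrictScalars ℝ).hasFDerivAt.comp_hasDerivAt t (hx t)
  have hs := fun t => symbol_apply (d := d) h₁ h₂ h₃ ξ (x t)
  refine ⟨⟨2 * Real.pi * ξ, damping d p (2 * Real.pi * ξ), fun t => (x t 0).re,
    fun t => (x t 1).im, fun t => (x t 2).im, fun t => (x t 3).re, fun t => (x t 4).im,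
    fun t => (x t 5).re, fun t => (x t 6).re, fun t => (x t 7).im, damping_nonneg d hk₅ _,
    fun t => (hasDerivAt_re (hc 0 t)).congr_deriv ?_, fun t => (hasDerivAt_im (hc 1 t)).congr_deriv ?_,
    fun t => (hasDerivAt_im (hc 2 t)).congr_deriv ?_, fun t => (hasDerivAt_re (hc 3 t)).congr_deriv ?_,
    fun t => (hasDerivAt_im (hc 4 t)).congr_deriv ?_, fun t => (hasDerivAt_re (hc 5 t)).congr_deriv ?_,
    fun t => (hasDerivAt_re (hc 6 t)).congr_deriv ?_, fun t => (hasDerivAt_im (hc 7 t)).congr_deriv ?_⟩,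
    ⟨2 * Real.pi * ξ, damping d p (2 * Real.pi * ξ), fun t => (x t 0).im,
    fun t => -(x t 1).re, fun t => -(x t 2).re, fun t => (x t 3).im, fun t => -(x t 4).re,
    fun t => (x t 5).im, fun t => (x t 6).im, fun t => -(x t 7).re, damping_nonneg d hk₅ _,
    fun t => (hasDerivAt_im (hc 0 t)).congr_deriv ?_, fun t => (hasDerivAt_re (hc 1 t)).neg.congr_deriv ?_,
    fun t => (hasDerivAt_re (hc 2 t)).neg.congr_deriv ?_, fun t => (hasDerivAt_im (hc 3 t)).congr_deriv ?_,
    fun t => (hasDerivAt_re (hc 4 t)).neg.congr_deriv ?_, fun t => (hasDerivAt_im (hc 5 t)).congr_deriv ?_,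
    fun t => (hasDerivAt_im (hc 6 t)).congr_deriv ?_, fun t => (hasDerivAt_re (hc 7 t)).neg.congr_deriv ?_⟩,
    rfl, rfl, rfl, rfl, fun t => ?_⟩
  case refine_17 =>
    rw [EuclideanSpace.norm_sq_eq, Fin.sum_univ_eight]
    simp only [Complex.sq_norm, Complex.normSq_apply, Mode.normSq]
    ring
  all_goals
    obtain ⟨e0, e1, e2, e3, e4, e5, e6, e7⟩ := hs t
    simp only [e0, e1, e2, e3, e4, e5, e6, e7, Complex.add_re, Complex.add_im, Complex.sub_re,
      Complex.sub_im, Complex.mul_re, Complex.mul_im, Complex.ofReal_re, Complex.ofReal_im,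
      Complex.I_re, Complex.I_im]
    ring

/-- Decay of the modes gives decay of the exponential of the symbol. -/
theorem exists_norm_exp_symbol_le {d : Dissipation} {p : Coeffs} (h₁ : p.τ₁ = 0) (h₂ : p.τ₂ = 0)
    (h₃ : p.τ₃ = 1) (hk₅ : 0 < p.k₅) {f : ℝ → ℝ}
    (h : ∃ C > 0, ∃ c > 0, ∀ X : Mode p, X.D = damping d p X.s → ∀ t, 0 ≤ t →
      X.normSq t ≤ C * Real.exp (-c * f X.s * t) * X.normSq 0) :
    ∃ C > 0, ∃ c > 0, ∀ (ξ : ℝ) (x : Vec) (t : ℝ), 0 ≤ t →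
      ‖NormedSpace.exp (t • symbol d p ξ) x‖ ≤
        C * Real.exp (-c * f (2 * Real.pi * ξ) * t) * ‖x‖ := by
  obtain ⟨C, hC, c, hc, h⟩ := h
  -- Modes bound squared norms, hence the square root of `C` and the halved rate.
  refine ⟨Real.sqrt C, Real.sqrt_pos.2 hC, c / 2, by positivity, fun ξ x t ht => ?_⟩
  have hx : ∀ t, HasDerivAt (fun t : ℝ => NormedSpace.exp (t • symbol d p ξ) x)
      (symbol d p ξ (NormedSpace.exp (t • symbol d p ξ) x)) t := fun t =>
    ((ContinuousLinearMap.apply ℝ Vec x).comp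
      (ContinuousLinearMap.restrictScalarsL ℂ Vec Vec ℝ ℝ)).hasFDerivAt.comp_hasDerivAt t
      (hasDerivAt_exp_smul_const' (𝕂 := ℝ) (symbol d p ξ) t)
  obtain ⟨X, Y, hX, hY, hXD, hYD, hn⟩ := exists_modes h₁ h₂ h₃ hk₅ ξ hx
  have h1 := h X (by rw [hXD, hX]) t ht
  have h2 := h Y (by rw [hYD, hY]) t ht
  have hx0 : NormedSpace.exp ((0 : ℝ) • symbol d p ξ) x = x := by
    rw [zero_smul ℝ (symbol d p ξ), NormedSpace.exp_zero]; rfl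
  have h0 := hn 0
  have ht' := hn t
  beta_reduce at h0 ht'
  rw [hx0] at h0
  refine (sq_le_sq₀ (norm_nonneg _) (by positivity)).1 ?_
  rw [ht', mul_pow, mul_pow, Real.sq_sqrt hC.le, h0, ← Real.exp_nat_mul]
  rw [hX] at h1
  rw [hY] at h2
  have : ((2 : ℕ) : ℝ) * (-(c / 2) * f (2 * Real.pi * ξ) * t) = -c * f (2 * Real.pi * ξ) * t := by
    push_cast; ring
  rw [this]
  linarith

/-! ### Uniqueness for evolution equations with bounded multipliers -/

/-- A function which is continuous on `[0, ∞)` with derivative zero on `(0, ∞)` is constant. -/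
theorem eq_zero_of_hasDerivAt_zero {E : Type*} [NormedAddCommGroup E] [NormedSpace ℝ E]
    [CompleteSpace E] {f : ℝ → E} (hf : ContinuousOn f (Set.Ici 0))
    (hf' : ∀ t, 0 < t → HasDerivAt f 0 t) {t : ℝ} (ht : 0 ≤ t) : f t = f 0 := by
  have := intervalIntegral.integral_eq_sub_of_hasDerivAt_of_le ht
    (hf.mono Set.Icc_subset_Ici_self) (fun x hx => hf' x hx.1) (by simp)
  rw [intervalIntegral.integral_zero] at this
  exact (sub_eq_zero.1 this.symm)

section exp

variable {A : Type*} [NormedRing A] [NormedAlgebra ℝ A] [CompleteSpace A]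

/-- Evaluation at a point is a continuous ring homomorphism, so it commutes with the exponential
series. -/
theorem exp_apply (F : ℝ →ᵇ A) (ξ : ℝ) : NormedSpace.exp F ξ = NormedSpace.exp (F ξ) := by
  let _ : NormedAlgebra ℚ (ℝ →ᵇ A) := NormedAlgebra.restrictScalars ℚ ℝ _
  let _ : NormedAlgebra ℚ A := NormedAlgebra.restrictScalars ℚ ℝ _
  let e : (ℝ →ᵇ A) →+* A :=
    { toFun := fun F => F ξ
      map_one' := rfl
      map_mul' := fun _ _ => rfl
      map_zero' := rfl
      map_add' := fun _ _ => rfl }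
  exact NormedSpace.map_exp e (continuous_eval_const ξ) F

theorem exp_smul_mul_exp_neg_smul (F : A) (t : ℝ) :
    NormedSpace.exp (t • F) * NormedSpace.exp ((-t) • F) = 1 := by
  let _ : NormedAlgebra ℚ A := NormedAlgebra.restrictScalars ℚ ℝ _
  rw [← NormedSpace.exp_add_of_commute, ← add_smul]
  · simp
  · exact ((Commute.refl F).smul_left t).smul_right (-t)

/-- Uniqueness for linear equations with bounded coefficients, in terms of a representation. -/
theorem eq_exp_of_hasDerivAt {H : Type*} [NormedAddCommGroup H] [NormedSpace ℝ H]
    [CompleteSpace H] (M : A →L[ℝ] H →L[ℝ] H) (hmul : ∀ a b v, M (a * b) v = M a (M b v))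
    (hone : ∀ v, M 1 v = v) (F : A) {V : ℝ → H} (hV : ContinuousOn V (Set.Ici 0))
    (hV' : ∀ t, 0 < t → HasDerivAt V (M F (V t)) t) {t : ℝ} (ht : 0 ≤ t) :
    V t = M (NormedSpace.exp (t • F)) (V 0) := by
  have hG : ∀ t : ℝ, HasDerivAt (fun t : ℝ => M (NormedSpace.exp ((-t) • F)))
      (M (-(NormedSpace.exp ((-t) • F) * F))) t := by
    intro t
    have h1 := (hasDerivAt_exp_smul_const (𝕂 := ℝ) F (-t)).scomp t (hasDerivAt_neg t)
    rw [neg_one_smul] at h1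
    exact M.hasFDerivAt.comp_hasDerivAt t h1
  -- `exp(-tF)` serves as integrating factor: applied to `V`, it gives a constant.
  have hY := eq_zero_of_hasDerivAt_zero
    (f := fun t => M (NormedSpace.exp ((-t) • F)) (V t)) ?_ ?_ ht
  · simp only [neg_zero, zero_smul, NormedSpace.exp_zero, hone] at hY
    rw [← hY, ← hmul, exp_smul_mul_exp_neg_smul, hone]
  · exact ContinuousOn.clm_apply (fun t _ => (hG t).continuousAt.continuousWithinAt) hV
  · intro t ht
    refine ((hG t).clm_apply (hV' t ht)).congr_deriv ?_
    rw [← hmul, map_neg]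
    simp

end exp

section multiplier

variable {A : Type*} [NormedRing A] [NormedAlgebra ℝ A] (ℓ : A →L[ℝ] Vec →L[ℝ] Vec)

theorem memLp_multiplier (F : ℝ →ᵇ A) (V : L2) :
    MemLp (fun ξ => ℓ (F ξ) (V ξ)) 2 (volume : Measure ℝ) := by
  refine (Lp.memLp V).of_le_mul (c := ‖ℓ‖ * ‖F‖) ?_ (Filter.Eventually.of_forall fun ξ => ?_)
  · exact ℓ.aestronglyMeasurable_comp₂
      F.continuous.aestronglyMeasurable (Lp.aestronglyMeasurable V)
  · refine (ℓ.le_opNorm₂ _ _).trans ?_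
    gcongr
    exact F.norm_coe_le_norm ξ

/-- Multiplication by a bounded continuous function with values in an algebra acting on `Vec`. -/
noncomputable def multiplier : (ℝ →ᵇ A) →L[ℝ] L2 →L[ℝ] L2 :=
  LinearMap.mkContinuous₂
    (LinearMap.mk₂ ℝ (fun F V => (memLp_multiplier ℓ F V).toLp _)
      (fun F G V => by
        rw [← MemLp.toLp_add]
        refine MemLp.toLp_congr _ _ (Filter.Eventually.of_forall fun ξ => ?_)
        simp)
      (fun c F V => by
        rw [← MemLp.toLp_const_smul]
        refine MemLp.toLp_congr _ _ (Filter.Eventually.of_forall fun ξ => ?_)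
        simp)
      (fun F V W => by
        rw [← MemLp.toLp_add]
        refine MemLp.toLp_congr _ _ ?_
        filter_upwards [Lp.coeFn_add V W] with ξ hξ
        rw [hξ]
        exact map_add (ℓ (F ξ)) (V ξ) (W ξ))
      (fun c F V => by
        rw [← MemLp.toLp_const_smul]
        refine MemLp.toLp_congr _ _ ?_
        filter_upwards [Lp.coeFn_smul c V] with ξ hξ
        rw [hξ]
        exact map_smul (ℓ (F ξ)) c (V ξ)))
    ‖ℓ‖ (fun F V => by
      refine Lp.norm_le_mul_norm_of_ae_le_mul ?_
      filter_upwards [(memLp_multiplier ℓ F V).coeFn_toLp] with ξ hξ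
      rw [LinearMap.mk₂_apply, hξ]
      refine (ℓ.le_opNorm₂ _ _).trans ?_
      gcongr
      exact F.norm_coe_le_norm ξ)

theorem coeFn_multiplier (F : ℝ →ᵇ A) (V : L2) :
    multiplier ℓ F V =ᵐ[volume] fun ξ => ℓ (F ξ) (V ξ) :=
  (memLp_multiplier ℓ F V).coeFn_toLp

theorem multiplier_mul (hmul : ∀ a b v, ℓ (a * b) v = ℓ a (ℓ b v)) (F G : ℝ →ᵇ A) (V : L2) :
    multiplier ℓ (F * G) V = multiplier ℓ F (multiplier ℓ G V) := by
  refine Lp.ext ?_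
  filter_upwards [coeFn_multiplier ℓ (F * G) V, coeFn_multiplier ℓ F (multiplier ℓ G V),
    coeFn_multiplier ℓ G V] with ξ h1 h2 h3
  rw [h1, h2, h3, BoundedContinuousFunction.coe_mul, Pi.mul_apply, hmul]

theorem multiplier_one (hone : ∀ v, ℓ 1 v = v) (V : L2) : multiplier ℓ 1 V = V := by
  refine Lp.ext ?_
  filter_upwards [coeFn_multiplier ℓ 1 V] with ξ h1
  rw [h1, BoundedContinuousFunction.coe_one, Pi.one_apply, hone]

theorem toTemperedDistribution_injective {f g : L2}
    (h : ∀ χ : 𝓢(ℝ, ℂ), (f : 𝓢'(ℝ, Vec)) χ = (g : 𝓢'(ℝ, Vec)) χ) : f = g := by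
  have h1 := Lp.ker_toTemperedDistributionCLM_eq_bot (F := Vec) (p := 2)
    (μ := (volume : Measure ℝ))
  rw [LinearMap.ker_eq_bot] at h1
  exact h1 (DFunLike.ext _ _ h)

/-- Evaluation at a test function, as a continuous linear map on `L²`. -/
noncomputable def evalTest (χ : 𝓢(ℝ, ℂ)) : L2 →L[ℝ] Vec where
  toFun f := (f : 𝓢'(ℝ, Vec)) χ
  map_add' f g := congrArg (fun T : 𝓢'(ℝ, Vec) => T χ)
    ((Lp.toTemperedDistributionCLM Vec volume 2).map_add f g)
  map_smul' c f := congrArg (fun T : 𝓢'(ℝ, Vec) => T χ)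
    ((Lp.toTemperedDistributionCLM Vec volume 2).map_smul_of_tower c f)
  cont := (continuous_eval_const χ).comp (Lp.toTemperedDistributionCLM Vec volume 2).continuous

/-- Uniqueness for the equation `V' = F V` with a bounded multiplier `F`, in its weak form. -/
theorem ae_eq_exp_multiplier [CompleteSpace A] (hmul : ∀ a b v, ℓ (a * b) v = ℓ a (ℓ b v))
    (hone : ∀ v, ℓ 1 v = v) {F : ℝ →ᵇ A} {V : ℝ → L2}
    (hV : ContinuousOn V (Set.Ici 0))
    (hV' : ∀ χ : 𝓢(ℝ, ℂ), ∀ t, 0 < t → HasDerivAt (fun s => (V s : 𝓢'(ℝ, Vec)) χ)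
      (((multiplier ℓ F (V t) : L2) : 𝓢'(ℝ, Vec)) χ) t) {t : ℝ} (ht : 0 ≤ t) :
    V t =ᵐ[volume] fun ξ => ℓ (NormedSpace.exp (t • F ξ)) (V 0 ξ) := by
  -- Replacing `s` by `max s 0` extends the integrand continuously to the whole line, so its
  -- primitive is differentiable everywhere in norm. Comparing `V` with this primitive against each
  -- test function upgrades the weak equation to a strong one.
  have hc : Continuous fun s => multiplier ℓ F (V (max s 0)) :=
    (multiplier ℓ F).continuous.comp (hV.comp_continuous (by fun_prop) fun s => le_max_right s 0)
  have hW : ∀ t, HasDerivAt (fun t => V 0 + ∫ s in (0 : ℝ)..t, multiplier ℓ F (V (max s 0)))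
      (multiplier ℓ F (V (max t 0))) t := fun t =>
    (intervalIntegral.integral_hasDerivAt_right (hc.intervalIntegrable _ _)
      (hc.stronglyMeasurableAtFilter _ _) hc.continuousAt).const_add _
  have hVW : ∀ t, 0 ≤ t → V t = V 0 + ∫ s in (0 : ℝ)..t, multiplier ℓ F (V (max s 0)) := by
    intro t ht
    refine toTemperedDistribution_injective fun χ => ?_
    have h1 := eq_zero_of_hasDerivAt_zero (f := fun t => evalTest χ (V t) -
      evalTest χ (V 0 + ∫ s in (0 : ℝ)..t, multiplier ℓ F (V (max s 0)))) ?_ ?_ ht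
    · simp only [intervalIntegral.integral_same, add_zero, sub_self] at h1
      exact sub_eq_zero.1 h1
    · exact ((evalTest χ).continuous.comp_continuousOn hV).sub
        ((evalTest χ).continuous.comp_continuousOn
          fun t _ => (hW t).continuousAt.continuousWithinAt)
    · intro t ht
      have h2 := (evalTest χ).hasFDerivAt.comp_hasDerivAt t (hW t)
      rw [max_eq_left ht.le] at h2
      exact ((hV' χ t ht).sub h2).congr_deriv (sub_self _)
  have hVd : ∀ t, 0 < t → HasDerivAt V (multiplier ℓ F (V t)) t := by
    intro t ht
    have h1 := hW t
    rw [max_eq_left ht.le] at h1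
    refine h1.congr_of_eventuallyEq ?_
    filter_upwards [lt_mem_nhds ht] with s hs using hVW s hs.le
  rw [eq_exp_of_hasDerivAt (multiplier ℓ) (multiplier_mul ℓ hmul) (multiplier_one ℓ hone) F
    hV hVd ht]
  filter_upwards [coeFn_multiplier ℓ (NormedSpace.exp (t • F)) (V 0)] with ξ hξ
  rw [hξ, exp_apply, BoundedContinuousFunction.coe_smul]

end multiplier

/-! ### Solutions in Fourier variables -/

/-- The Fourier symbol `2πiξ` of `∂ₓ`. -/
noncomputable def freq (ξ : ℝ) : ℂ := (2 * Real.pi * ξ : ℝ) * Complex.I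

theorem hasTemperateGrowth_freq : freq.HasTemperateGrowth := by
  unfold freq; fun_prop

theorem hasTemperateGrowth_freq_pow (n : ℕ) : (fun ξ => freq ξ ^ n).HasTemperateGrowth := by
  induction n with
  | zero => simp
  | succ n ih =>
    simp only [pow_succ]
    exact ih.mul hasTemperateGrowth_freq

theorem fourier_dx (f : 𝓢'(ℝ, Vec)) :
    𝓕 (dx f) = TemperedDistribution.smulLeftCLM Vec freq (𝓕 f) := by
  have h : freq = (2 * Real.pi * Complex.I : ℂ) • fun x : ℝ => ((inner ℝ x 1 : ℝ) : ℂ) := by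
    funext x
    simp [freq]
    ring
  rw [dx, TemperedDistribution.fourier_lineDerivOp_eq, h,
    TemperedDistribution.smulLeftCLM_smul (by fun_prop)]
  rfl

theorem fourier_dx_iterate (n : ℕ) (f : 𝓢'(ℝ, Vec)) :
    𝓕 (dx^[n] f) = TemperedDistribution.smulLeftCLM Vec (fun ξ => freq ξ ^ n) (𝓕 f) := by
  induction n with
  | zero => simp
  | succ n ih =>
    rw [Function.iterate_succ_apply', fourier_dx, ih,
      TemperedDistribution.smulLeftCLM_smulLeftCLM_apply (hasTemperateGrowth_freq_pow n)
        hasTemperateGrowth_freq]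
    congr 1

/-- Testing against `𝓕 χ` transfers the transform to the distribution, where derivatives become
factors `freq`. Weak statements in `x` pass to the frequency side through this identity. -/
theorem dx_iterate_fourier_apply (n : ℕ) (f : L2) (χ : 𝓢(ℝ, ℂ)) :
    (dx^[n] (f : 𝓢'(ℝ, Vec))) (𝓕 χ) =
      ∫ ξ, (freq ξ ^ n * χ ξ) • (𝓕 f : L2) ξ := by
  rw [← TemperedDistribution.fourier_apply, fourier_dx_iterate,
    Lp.fourier_toTemperedDistribution_eq, TemperedDistribution.smulLeftCLM_apply_apply,
    Lp.toTemperedDistribution_apply]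
  simp [SchwartzMap.smulLeftCLM_apply_apply (hasTemperateGrowth_freq_pow n)]

theorem integrable_freq_pow_smul (n : ℕ) (f : L2) (χ : 𝓢(ℝ, ℂ)) :
    Integrable (fun ξ => (freq ξ ^ n * χ ξ) • f ξ) := by
  have h := (Lp.memLp f).smul (p := 2) (r := 1)
    ((SchwartzMap.smulLeftCLM ℂ (fun ξ => freq ξ ^ n) χ).memLp 2 volume)
  rw [memLp_one_iff_integrable] at h
  refine h.congr (Filter.Eventually.of_forall fun ξ => ?_)
  simp [SchwartzMap.smulLeftCLM_apply_apply (hasTemperateGrowth_freq_pow n)]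

theorem act_eq (A : Matrix (Fin 8) (Fin 8) ℂ) (x : Vec) :
    act A x = Matrix.toEuclideanCLM (𝕜 := ℂ) (n := Fin 8) A x := by
  rw [act, ← Matrix.coe_toEuclideanCLM_eq_toEuclideanLin]
  rfl

theorem symbol_eq (d : Dissipation) (p : Coeffs) (ξ : ℝ) (x : Vec) :
    symbol d p ξ x = -(freq ξ ^ 2 • act (A₂ d p) x + freq ξ • act (A₁ p) x + act (A₀ d p) x) := by
  simp only [symbol, symbolMatrix, act_eq, map_neg, map_add, map_smul, freq]
  simp

theorem continuous_symbol (d : Dissipation) (p : Coeffs) : Continuous (symbol d p) := by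
  have h : symbol d p = fun ξ => -(freq ξ ^ 2 • Matrix.toEuclideanCLM (𝕜 := ℂ) (n := Fin 8) (A₂ d p)
      + freq ξ • Matrix.toEuclideanCLM (𝕜 := ℂ) (n := Fin 8) (A₁ p)
      + Matrix.toEuclideanCLM (𝕜 := ℂ) (n := Fin 8) (A₀ d p)) := by
    funext ξ
    simp only [symbol, symbolMatrix, map_neg, map_add, map_smul, freq]
  have := hasTemperateGrowth_freq.1.continuous
  rw [h]
  fun_prop

/-- The equation, after a Fourier transform. -/
theorem IsSolution.hasDerivAt_fourier {d : Dissipation} {p : Coeffs} {U₀ : L2} {U : ℝ → L2}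
    (hU : IsSolution d p U₀ U) (χ : 𝓢(ℝ, ℂ)) {t : ℝ} (ht : 0 < t) :
    HasDerivAt (fun s => ∫ ξ, χ ξ • (𝓕 (U s) : L2) ξ)
      (∫ ξ, χ ξ • symbol d p ξ ((𝓕 (U t) : L2) ξ)) t := by
  have h := hU.equation (𝓕 χ) t ht
  have h0 : ∀ s, (U s : 𝓢'(ℝ, Vec)) (𝓕 χ) = ∫ ξ, χ ξ • (𝓕 (U s) : L2) ξ := fun s => by
    simpa using dx_iterate_fourier_apply 0 (U s) χ
  simp only [h0] at h
  refine h.congr_deriv ?_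
  have h1 := dx_iterate_fourier_apply 1 (U t) χ
  have h2 := dx_iterate_fourier_apply 2 (U t) χ
  have i0 := integrable_freq_pow_smul 0 (𝓕 (U t)) χ
  have i1 := integrable_freq_pow_smul 1 (𝓕 (U t)) χ
  have i2 := integrable_freq_pow_smul 2 (𝓕 (U t)) χ
  simp only [pow_zero, one_mul, pow_one, Function.iterate_succ, Function.iterate_zero,
    Function.comp_apply, id_eq] at h1 h2 i0 i1
  rw [h1, h2]
  simp only [act_eq]
  rw [← ContinuousLinearMap.integral_comp_comm _ i0, ← ContinuousLinearMap.integral_comp_comm _ i1,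
    ← ContinuousLinearMap.integral_comp_comm _ i2, ← integral_add, ← integral_add, ← integral_neg]
  · refine integral_congr_ae (Filter.Eventually.of_forall fun ξ => ?_)
    simp only [symbol_eq, act_eq, map_smul, smul_neg, smul_add, smul_smul]
    rw [mul_comm (χ ξ) (freq ξ ^ 2), mul_comm (χ ξ) (freq ξ)]
  · exact (ContinuousLinearMap.integrable_comp _ i2).add (ContinuousLinearMap.integrable_comp _ i1)
  · exact ContinuousLinearMap.integrable_comp _ i0
  · exact ContinuousLinearMap.integrable_comp _ i2
  · exact ContinuousLinearMap.integrable_comp _ i1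

/-- The action of the endomorphisms on `Vec`, with real scalars. -/
noncomputable def endAction : (Vec →L[ℂ] Vec) →L[ℝ] Vec →L[ℝ] Vec :=
  ContinuousLinearMap.restrictScalarsL ℂ Vec Vec ℝ ℝ

theorem endAction_apply (F : Vec →L[ℂ] Vec) (x : Vec) : endAction F x = F x := rfl

/-- Clamping the frequency keeps the symbol continuous and makes it bounded, as required by the
Banach algebra in which the exponential is taken. -/
theorem exists_bounded_symbol (d : Dissipation) (p : Coeffs) (R : ℝ) :
    ∃ F : ℝ →ᵇ (Vec →L[ℂ] Vec), ∀ ξ, |ξ| ≤ R → F ξ = symbol d p ξ := by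
  have hc : Continuous fun ξ => symbol d p (max (-R) (min R ξ)) :=
    (continuous_symbol d p).comp (by fun_prop)
  obtain ⟨C, hC⟩ := (isCompact_Icc (a := -|R|) (b := |R|)).exists_bound_of_continuousOn
    (continuous_symbol d p).continuousOn
  refine ⟨BoundedContinuousFunction.ofNormedAddCommGroup _ hc C fun ξ => hC _ ⟨?_, ?_⟩, ?_⟩
  · exact (neg_le_neg (le_abs_self R)).trans (le_max_left _ _)
  · exact max_le (neg_le_abs R) ((min_le_left _ _).trans (le_abs_self R))
  · intro ξ hξ
    rw [abs_le] at hξ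
    simp [hξ.1, hξ.2]

theorem exists_scalar_multiplier (b : 𝓢(ℝ, ℂ)) :
    ∃ B : ℝ →ᵇ (Vec →L[ℂ] Vec), ∀ ξ x, B ξ x = b ξ • x := by
  obtain ⟨C, hC⟩ := b.decay 0 0
  have hc : Continuous fun ξ => b ξ • (1 : Vec →L[ℂ] Vec) :=
    b.continuous.smul continuous_const
  refine ⟨BoundedContinuousFunction.ofNormedAddCommGroup _ hc (C * ‖(1 : Vec →L[ℂ] Vec)‖)
    fun ξ => ?_, fun ξ x => rfl⟩
  rw [norm_smul]
  gcongr
  simpa using hC.2 ξ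

/-- Smooth cutoffs. -/
theorem exists_cutoff (n : ℕ) : ∃ b : 𝓢(ℝ, ℂ),
    (∀ ξ : ℝ, |ξ| ≤ n → b ξ = 1) ∧ ∀ ξ : ℝ, n + 1 < |ξ| → b ξ = 0 := by
  obtain ⟨b, hn1, hn2⟩ : ∃ b : ContDiffBump (0 : ℝ), n ≤ b.rIn ∧ b.rOut = n + 1 :=
    -- The inner radius must be positive even for `n = 0`, hence `n + 1/2`.
    ⟨⟨n + 1 / 2, n + 1, by positivity, by linarith⟩, by simp, rfl⟩
  have hb1 : ContDiff ℝ (⊤ : ℕ∞) fun ξ => (b ξ : ℂ) :=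
    Complex.ofRealCLM.contDiff.comp b.contDiff
  have hb2 : HasCompactSupport fun ξ => (b ξ : ℂ) := 
    b.hasCompactSupport.comp_left (g := Complex.ofReal) Complex.ofReal_zero
  refine ⟨hb2.toSchwartzMap hb1, fun ξ hξ => ?_, fun ξ hξ => ?_⟩
  · have : b ξ = 1 := b.one_of_mem_closedBall (by
      rw [mem_closedBall_zero_iff, Real.norm_eq_abs]
      exact hξ.trans hn1)
    simp [this]
  · have : b ξ = 0 := b.zero_of_le_dist (by
      rw [Real.dist_eq, sub_zero, hn2]; exact hξ.le)
    simp [this]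

/-- The equation for the Fourier transform, localized by a cutoff. -/
theorem IsSolution.hasDerivAt_cutoff {d : Dissipation} {p : Coeffs} {U₀ : L2} {U : ℝ → L2}
    (hU : IsSolution d p U₀ U) {b : 𝓢(ℝ, ℂ)} {B F : ℝ →ᵇ (Vec →L[ℂ] Vec)}
    (hB : ∀ ξ x, B ξ x = b ξ • x) (hF : ∀ ξ, b ξ = 0 ∨ F ξ = symbol d p ξ) (χ : 𝓢(ℝ, ℂ))
    {t : ℝ} (ht : 0 < t) :
    HasDerivAt (fun s => ((multiplier endAction B (𝓕 (U s)) : L2) : 𝓢'(ℝ, Vec)) χ)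
      (((multiplier endAction F (multiplier endAction B (𝓕 (U t))) : L2) : 𝓢'(ℝ, Vec)) χ) t := by
  have hψ : ∀ ξ, SchwartzMap.smulLeftCLM ℂ (fun ξ => b ξ) χ ξ = b ξ * χ ξ := fun ξ => by
    rw [SchwartzMap.smulLeftCLM_apply_apply b.hasTemperateGrowth]; rfl
  have h1 := hU.hasDerivAt_fourier (SchwartzMap.smulLeftCLM ℂ (fun ξ => b ξ) χ) ht
  have h2 : ∀ s, ((multiplier endAction B (𝓕 (U s)) : L2) : 𝓢'(ℝ, Vec)) χ =
      ∫ ξ, SchwartzMap.smulLeftCLM ℂ (fun ξ => b ξ) χ ξ • (𝓕 (U s) : L2) ξ := by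
    intro s
    rw [Lp.toTemperedDistribution_apply]
    refine integral_congr_ae ?_
    filter_upwards [coeFn_multiplier endAction B (𝓕 (U s))] with ξ hξ
    rw [hξ, hψ, endAction_apply, hB, smul_smul, mul_comm]
  simp only [h2]
  refine h1.congr_deriv ?_
  rw [Lp.toTemperedDistribution_apply]
  refine integral_congr_ae ?_
  filter_upwards [coeFn_multiplier endAction B (𝓕 (U t)), coeFn_multiplier endAction F
    (multiplier endAction B (𝓕 (U t)))] with ξ hξ hξ'
  rw [hξ', hξ, hψ, endAction_apply, endAction_apply, hB, map_smul, smul_smul, mul_comm]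
  rcases hF ξ with h | h
  · simp [h]
  · rw [h]

/-- The Fourier transform of a solution. -/
theorem IsSolution.fourier_ae_eq {d : Dissipation} {p : Coeffs} {U₀ : L2} {U : ℝ → L2}
    (hU : IsSolution d p U₀ U) {t : ℝ} (ht : 0 ≤ t) :
    (𝓕 (U t) : L2) =ᵐ[volume] fun ξ => NormedSpace.exp (t • symbol d p ξ) ((𝓕 U₀ : L2) ξ) := by
  -- The symbol need not be bounded on the whole line, so the identity is proved on each bounded
  -- band. There a cutoff of `Û` solves an equation with a bounded multiplier, as the cutoff
  -- vanishes where that multiplier may differ from the symbol.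
  suffices h : ∀ n : ℕ, ∀ᵐ ξ : ℝ, |ξ| ≤ n →
      (𝓕 (U t) : L2) ξ = NormedSpace.exp (t • symbol d p ξ) ((𝓕 U₀ : L2) ξ) by
    filter_upwards [ae_all_iff.2 h] with ξ hξ
    obtain ⟨n, hn⟩ := exists_nat_ge |ξ|
    exact hξ n hn
  intro n
  obtain ⟨F, hF⟩ := exists_bounded_symbol d p (n + 1)
  obtain ⟨b, hb1, hb0⟩ := exists_cutoff n
  obtain ⟨B, hB⟩ := exists_scalar_multiplier b
  have hcont : ContinuousOn (fun t => (𝓕 (U t) : L2)) (Set.Ici 0) :=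
    (Lp.fourierTransformₗᵢ ℝ Vec).continuous.comp_continuousOn hU.continuousOn
  have key := ae_eq_exp_multiplier endAction (fun _ _ _ => rfl) (fun _ => rfl) (F := F)
    (V := fun t => multiplier endAction B (𝓕 (U t)))
    ((multiplier endAction B).continuous.comp_continuousOn hcont)
    (fun χ t ht => hU.hasDerivAt_cutoff hB (fun ξ => (le_or_gt |ξ| (n + 1)).elim
      (fun h => Or.inr (hF ξ h)) (fun h => Or.inl (hb0 ξ h))) χ ht) ht
  filter_upwards [key, coeFn_multiplier endAction B (𝓕 (U t)),
    coeFn_multiplier endAction B (𝓕 (U 0))] with ξ h1 h2 h3 hξ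
  rw [h2, h3, endAction_apply, endAction_apply, endAction_apply, hB, hB, hb1 ξ hξ,
    hF ξ (by linarith), hU.initial, one_smul, one_smul] at h1
  exact h1

/-! ### Derivatives and initial data on the frequency side -/

/-- The derivatives in `L²` are obtained by multiplication of the Fourier transform. -/
theorem isL2Deriv_fourierInv {n : ℕ} {f G : L2}
    (hG : G =ᵐ[volume] fun ξ => freq ξ ^ n • (𝓕 f : L2) ξ) : IsL2Deriv n f (𝓕⁻ G) := by
  have h : 𝓕 (((𝓕⁻ G : L2) : L2) : 𝓢'(ℝ, Vec)) = 𝓕 (dx^[n] (f : 𝓢'(ℝ, Vec))) := by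
    rw [Lp.fourier_toTemperedDistribution_eq, FourierTransform.fourier_fourierInv_eq]
    refine DFunLike.ext _ _ fun χ => ?_
    rw [TemperedDistribution.fourier_apply, dx_iterate_fourier_apply,
      Lp.toTemperedDistribution_apply]
    refine integral_congr_ae ?_
    filter_upwards [hG] with ξ hξ
    rw [hξ, smul_smul, mul_comm]
  have h' := congrArg (fun T => 𝓕⁻ T) h
  simpa [IsL2Deriv] using h'

theorem locallyIntegrable_coeFn (f : L2) : LocallyIntegrable f (volume : Measure ℝ) :=
  (Lp.memLp f).locallyIntegrable one_le_two

/-- The Fourier transform of an integrable function is bounded. -/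
theorem norm_fourier_le {f : L2} (hf : Integrable f volume) :
    ∀ᵐ ξ, ‖(𝓕 f : L2) ξ‖ ≤ ∫ x, ‖f x‖ := by
  have hc : Continuous (𝓕 (f : ℝ → Vec)) :=
    VectorFourier.fourierIntegral_continuous Real.continuous_fourierChar
      (by exact continuous_inner) hf
  have h : ∀ᵐ ξ, (𝓕 f : L2) ξ = 𝓕 (f : ℝ → Vec) ξ := by
    -- The `L²` transform and the integral transform agree a.e. because, paired with a smooth
    -- compactly supported `g`, both equal the pairing of `f` with the transform of `g`.
    refine ae_eq_of_integral_contDiff_smul_eq (locallyIntegrable_coeFn _) hc.locallyIntegrable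
      fun g hg1 hg2 => ?_
    have h1 : ContDiff ℝ (⊤ : ℕ∞) fun ξ => (g ξ : ℂ) := Complex.ofRealCLM.contDiff.comp hg1
    have h2 : HasCompactSupport fun ξ => (g ξ : ℂ) :=
      hg2.comp_left (g := Complex.ofReal) Complex.ofReal_zero
    have h3 := dx_iterate_fourier_apply 0 f (h2.toSchwartzMap h1)
    simp only [pow_zero, one_mul, Function.iterate_zero, id_eq,
      Lp.toTemperedDistribution_apply] at h3
    have h4 := VectorFourier.integral_fourierIntegral_smul_eq_flip (L := innerₗ ℝ)
      Real.continuous_fourierChar continuous_inner ((h2.toSchwartzMap h1).integrable (μ := volume)) hf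
    rw [SchwartzMap.fourier_coe] at h3
    have h5 : (VectorFourier.fourierIntegral Real.fourierChar volume (innerₗ ℝ).flip f)
      = 𝓕 (f : ℝ → Vec) := by rw [flip_innerₗ]; rfl
    rw [h5] at h4
    have h6 := h3.symm.trans h4
    simpa using h6
  filter_upwards [h] with ξ hξ
  rw [hξ]
  exact VectorFourier.norm_fourierIntegral_le_integral_norm _ _ _ _ _

theorem norm_freq (ξ : ℝ) : ‖freq ξ‖ = |2 * Real.pi * ξ| := by
  rw [freq, norm_mul, Complex.norm_real, Complex.norm_I, mul_one, Real.norm_eq_abs]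

theorem continuous_freq : Continuous freq := hasTemperateGrowth_freq.1.continuous

theorem aestronglyMeasurable_freq_pow_smul (n : ℕ) (f : L2) :
    AEStronglyMeasurable (fun ξ => freq ξ ^ n • f ξ) (volume : Measure ℝ) :=
  (continuous_freq.pow n).aestronglyMeasurable.smul (Lp.aestronglyMeasurable f)

/-- The derivatives of Sobolev functions are in `L²`. -/
theorem memLp_freq_pow_smul {N m : ℕ} (hm : m ≤ N) {f : L2}
    (hf : TemperedDistribution.MemSobolev (N : ℝ) 2 (f : 𝓢'(ℝ, Vec))) :
    MemLp (fun ξ => freq ξ ^ m • (𝓕 f : L2) ξ) 2 (volume : Measure ℝ) := by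
  obtain ⟨g, hg⟩ := TemperedDistribution.memSobolev_iff_exists_smulLeftCLM_fourier.1 hf
  have hw : (fun x : ℝ => (((1 + ‖x‖ ^ 2) ^ ((N : ℝ) / 2) : ℝ) : ℂ)).HasTemperateGrowth := by
    fun_prop
  have hwc : Continuous fun x : ℝ => (((1 + ‖x‖ ^ 2) ^ ((N : ℝ) / 2) : ℝ) : ℂ) := hw.1.continuous
  -- Sobolev membership is an identity of distributions; test functions turn it into an identity
  -- almost everywhere.
  have hae : ∀ᵐ ξ, (((1 + ‖ξ‖ ^ 2) ^ ((N : ℝ) / 2) : ℝ) : ℂ) • (𝓕 f : L2) ξ = g ξ := by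
    refine ae_eq_of_integral_contDiff_smul_eq
      ((locallyIntegrable_coeFn _).continuous_smul hwc) (locallyIntegrable_coeFn _)
      fun b hb1 hb2 => ?_
    have h1 : ContDiff ℝ (⊤ : ℕ∞) fun ξ => (b ξ : ℂ) := Complex.ofRealCLM.contDiff.comp hb1
    have h2 : HasCompactSupport fun ξ => (b ξ : ℂ) :=
      hb2.comp_left (g := Complex.ofReal) Complex.ofReal_zero
    have h3 := congrArg (fun T : 𝓢'(ℝ, Vec) => T (h2.toSchwartzMap h1)) hg
    rw [Lp.fourier_toTemperedDistribution_eq] at h3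
    rw [TemperedDistribution.smulLeftCLM_apply_apply] at h3
    rw [Lp.toTemperedDistribution_apply, Lp.toTemperedDistribution_apply] at h3
    refine Eq.trans (integral_congr_ae (Filter.Eventually.of_forall fun ξ => ?_)) (h3.trans
      (integral_congr_ae (Filter.Eventually.of_forall fun ξ => ?_)))
    · simp only [SchwartzMap.smulLeftCLM_apply_apply hw, smul_eq_mul]
      rw [mul_comm, ← smul_smul]
      simp
    · simp
  refine (Lp.memLp g).of_le_mul (c := (2 * Real.pi) ^ m) (aestronglyMeasurable_freq_pow_smul _ _) ?_
  filter_upwards [hae] with ξ hξ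
  rw [← hξ, norm_smul, norm_smul, norm_pow, norm_freq, Complex.norm_real, abs_mul, mul_pow,
    abs_of_pos Real.two_pi_pos, mul_assoc]
  gcongr
  have h1 : 1 ≤ 1 + ‖ξ‖ ^ 2 := by nlinarith [sq_nonneg ‖ξ‖]
  calc |ξ| ^ m = (|ξ| ^ 2) ^ ((m : ℝ) / 2) := by
        rw [← Real.rpow_natCast, ← Real.rpow_natCast, ← Real.rpow_mul (abs_nonneg _)]
        congr 1; push_cast; ring
    _ ≤ (1 + ‖ξ‖ ^ 2) ^ ((m : ℝ) / 2) := by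
        gcongr
        rw [Real.norm_eq_abs]; linarith
    _ ≤ (1 + ‖ξ‖ ^ 2) ^ ((N : ℝ) / 2) := by
        gcongr
    _ ≤ _ := Real.le_norm_self _

theorem integrable_comp_abs_of_integrableOn {f : ℝ → ℝ} (hf : IntegrableOn f (Set.Ioi 0)) :
    Integrable (fun x => f |x|) (volume : Measure ℝ) := by
  have h1 : IntegrableOn (fun x => f |x|) (Set.Ioi 0) :=
    hf.congr_fun (fun x hx => by rw [abs_of_pos hx]) measurableSet_Ioi
  have h2 : IntegrableOn (fun x => f |x|) (Set.Iio 0) := by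
    have h3 : IntegrableOn (fun x => f (-x)) (Set.Iio 0) := by
      have := (Measure.measurePreserving_neg (volume : Measure ℝ)).integrableOn_comp_preimage
        (MeasurableEquiv.neg ℝ).measurableEmbedding (f := f) (s := Set.Ioi 0)
      simpa [Function.comp_def] using this.2 hf
    exact h3.congr_fun (fun x hx => by rw [abs_of_neg hx]) measurableSet_Iio
  have h4 := ((integrableOn_Iic_iff_integrableOn_Iio (by simp)).2 h2).union h1
  rwa [Set.Iic_union_Ioi, integrableOn_univ] at h4

/-! ### Low and high frequency bounds -/

/-- The `L²` norm of the low frequency profile. -/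
theorem exists_eLpNorm_profile_le (j : ℕ) {n : ℕ} (hn : 0 < n) {a : ℝ} (ha : 0 < a) :
    ∃ K > 0, ∀ τ : ℝ, 0 < τ →
      MemLp (fun ξ : ℝ => |2 * Real.pi * ξ| ^ j * Real.exp (-(a * |2 * Real.pi * ξ| ^ n * τ))) 2
        volume ∧
      eLpNorm (fun ξ : ℝ => |2 * Real.pi * ξ| ^ j * Real.exp (-(a * |2 * Real.pi * ξ| ^ n * τ))) 2
        volume ≤ ENNReal.ofReal (K * τ ^ (-(1 / (2 * (n : ℝ))) - (j : ℝ) / n)) := by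
  have hn' : (0 : ℝ) < n := by exact_mod_cast hn
  -- The square of the profile is a Gamma integral with exponent `q`. Half of `(q + 1)/n` is `1/(2n)
  -- + j/n`.
  set q : ℝ := 2 * j with hq
  have hq1 : -1 < q := by have : (0 : ℝ) ≤ 2 * j := by positivity
                          linarith
  set M : ℝ := |(2 * Real.pi)⁻¹| * (2 * ((2 * a) ^ (-(q + 1) / n) * (1 / n)
    * Real.Gamma ((q + 1) / n))) with hM
  have hG : 0 < Real.Gamma ((q + 1) / n) := Real.Gamma_pos_of_pos (by
    apply div_pos _ hn'; linarith)
  have hMpos : 0 < M := by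
    have : (2 * Real.pi)⁻¹ ≠ 0 := inv_ne_zero Real.two_pi_pos.ne'
    positivity
  refine ⟨Real.sqrt M, Real.sqrt_pos.2 hMpos, fun τ hτ => ?_⟩
  set g : ℝ → ℝ := fun x => x ^ q * Real.exp (-(2 * a * τ) * x ^ (n : ℝ)) with hg
  have hsq : ∀ ξ : ℝ, (|2 * Real.pi * ξ| ^ j * Real.exp (-(a * |2 * Real.pi * ξ| ^ n * τ))) ^ 2
      = g |2 * Real.pi * ξ| := by
    intro ξ
    rw [hg, mul_pow, ← Real.exp_nat_mul, ← pow_mul]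
    beta_reduce
    rw [Real.rpow_natCast, hq, ← Nat.cast_two, ← Nat.cast_mul, Real.rpow_natCast, mul_comm j 2]
    congr 2
    push_cast; ring
  have hgi : Integrable fun x => g |x| := integrable_comp_abs_of_integrableOn
    (integrableOn_rpow_mul_exp_neg_mul_rpow hq1 hn' (by positivity))
  have hgi' : Integrable fun ξ => g |2 * Real.pi * ξ| :=
    (integrable_comp_mul_left_iff (fun x => g |x|) Real.two_pi_pos.ne').2 hgi
  have hint : ∫ ξ, g |2 * Real.pi * ξ| = M * τ ^ (-(q + 1) / n) := by
    rw [Measure.integral_comp_mul_left (fun x => g |x|), integral_comp_abs,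
      integral_rpow_mul_exp_neg_mul_rpow hn' hq1 (by positivity),
      Real.mul_rpow (by positivity) hτ.le, smul_eq_mul, hM]
    ring
  have hmem : MemLp (fun ξ : ℝ => |2 * Real.pi * ξ| ^ j *
      Real.exp (-(a * |2 * Real.pi * ξ| ^ n * τ))) 2 volume := by
    rw [memLp_two_iff_integrable_sq (by
      apply Continuous.aestronglyMeasurable; fun_prop)]
    exact hgi'.congr (Filter.Eventually.of_forall fun ξ => (hsq ξ).symm)
  refine ⟨hmem, le_of_eq ?_⟩
  rw [hmem.eLpNorm_eq_integral_rpow_norm two_ne_zero ENNReal.ofNat_ne_top]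
  congr 1
  have h1 : ∫ ξ : ℝ, ‖|2 * Real.pi * ξ| ^ j *
      Real.exp (-(a * |2 * Real.pi * ξ| ^ n * τ))‖ ^ (2 : ENNReal).toReal =
      M * τ ^ (-(q + 1) / n) := by
    rw [← hint]
    refine integral_congr_ae (Filter.Eventually.of_forall fun ξ => ?_)
    beta_reduce
    rw [← hsq, ENNReal.toReal_ofNat, Real.rpow_ofNat, Real.norm_eq_abs, sq_abs]
  rw [h1, ENNReal.toReal_ofNat, Real.mul_rpow hMpos.le (by positivity), ← Real.rpow_mul hτ.le,
    Real.sqrt_eq_rpow]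
  congr 2
  · norm_num
  · rw [hq]; field_simp; ring

/-- The inequality `x + 1 ≤ exp x` at `x = c * y / r`, raised to the power `r`. -/
theorem exists_exp_neg_le_rpow {c r : ℝ} (hc : 0 < c) (hr : 0 < r) :
    ∃ K > 0, ∀ y : ℝ, 0 < y → Real.exp (-(c * y)) ≤ K * y ^ (-r) := by
  refine ⟨(r / c) ^ r, by positivity, fun y hy => ?_⟩
  have h1 : y ≤ r / c * Real.exp (c * y / r) := by
    have := Real.add_one_le_exp (c * y / r)
    calc y = r / c * (c * y / r) := by field_simp
      _ ≤ _ := by gcongr; linarith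
  have h2 : y ^ r ≤ (r / c) ^ r * Real.exp (c * y) := by
    calc y ^ r ≤ (r / c * Real.exp (c * y / r)) ^ r := by gcongr
      _ = _ := by
        rw [Real.mul_rpow (by positivity) (by positivity), ← Real.exp_mul]
        congr 2; field_simp
  rw [Real.exp_neg, Real.rpow_neg hy.le, ← div_eq_mul_inv, le_div_iff₀ (by positivity),
    inv_mul_le_iff₀ (by positivity), mul_comm]
  exact h2

/-- The high frequency bound with a loss of regularity. -/
theorem exists_exp_neg_div_le {c : ℝ} (hc : 0 < c) {l m : ℕ} (hl : 1 ≤ l) (hm : 0 < m) :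
    ∃ K > 0, ∀ s t : ℝ, 1 ≤ |s| → 0 ≤ t →
      Real.exp (-(c / |s| ^ m * t)) ≤ K * (1 + t) ^ (-((l : ℝ) / m)) * |s| ^ l := by
  have hl' : (0 : ℝ) < l := by exact_mod_cast hl
  have hm' : (0 : ℝ) < m := by exact_mod_cast hm
  obtain ⟨K, hK, h⟩ := exists_exp_neg_le_rpow hc (r := l / m) (by positivity)
  refine ⟨Real.exp c * K, by positivity, fun s t hs ht => ?_⟩
  have hs0 : 0 < |s| := by linarith
  have h1 := h ((1 + t) / |s| ^ m) (by positivity)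
  have h2 : ((1 + t) / |s| ^ m) ^ (-((l : ℝ) / m)) = (1 + t) ^ (-((l : ℝ) / m)) * |s| ^ l := by
    rw [Real.div_rpow (by positivity) (by positivity), ← Real.rpow_natCast |s| m,
      ← Real.rpow_mul hs0.le, ← Real.rpow_natCast |s| l, div_eq_mul_inv, ← Real.rpow_neg hs0.le]
    congr 2; field_simp
  -- The factor `exp c` pays for replacing `t` by `1 + t`, since `|s| ≥ 1`.
  have h3 : -(c / |s| ^ m * t) ≤ c + -(c * ((1 + t) / |s| ^ m)) := by
    have : c / |s| ^ m ≤ c := div_le_self hc.le (one_le_pow₀ hs)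
    have h4 : c * ((1 + t) / |s| ^ m) = c / |s| ^ m + c / |s| ^ m * t := by ring
    linarith
  calc _ ≤ Real.exp (c + -(c * ((1 + t) / |s| ^ m))) := Real.exp_le_exp.2 h3
    _ = Real.exp c * Real.exp (-(c * ((1 + t) / |s| ^ m))) := Real.exp_add _ _
    _ ≤ Real.exp c * (K * ((1 + t) / |s| ^ m) ^ (-((l : ℝ) / m))) := by gcongr
    _ = _ := by rw [h2]; ring

theorem decayEstimate_mono {j l : ℕ} {a a' b b' : ℝ → ℝ} {U₀ : L2} {U : ℝ → L2}
    (h : DecayEstimate j l a b U₀ U) (ha : ∀ t, 0 ≤ t → a t ≤ a' t)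
    (hb : ∀ t, 0 ≤ t → b t ≤ b' t) : DecayEstimate j l a' b' U₀ U := by
  intro t ht
  obtain ⟨V, W, hV, hW, h⟩ := h t ht
  refine ⟨V, W, hV, hW, h.trans ?_⟩
  have : 0 ≤ ∫ x, ‖U₀ x‖ := integral_nonneg fun _ => norm_nonneg _
  gcongr
  · exact ha t ht
  · exact hb t ht

theorem fourier_symm_norm (G : L2) : ‖(𝓕⁻ G : L2)‖ = ‖G‖ :=
  (Lp.fourierTransformₗᵢ ℝ Vec).symm.norm_map G

/-- The pointwise bound in the frequency space, for a rate `r`. -/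
theorem freq_bound {s r t a c C B I x x₀ : ℝ} {j l n : ℕ} (ha : 0 ≤ a) (hC : 0 ≤ C)
    (hB : 0 ≤ B) (hI : 0 ≤ I) (hx₀ : 0 ≤ x₀) (hx₀I : x₀ ≤ I)
    (hx : x ≤ C * Real.exp (-c * r * t) * x₀)
    (hlow : |s| ≤ 1 → a * |s| ^ n * t ≤ c * r * t)
    (hhigh : 1 ≤ |s| → Real.exp (-c * r * t) ≤ B * |s| ^ l) :
    |s| ^ j * x ≤ C * Real.exp a * I * (|s| ^ j * Real.exp (-(a * |s| ^ n * (1 + t)))) +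
      C * B * (|s| ^ (j + l) * x₀) := by
  have hs := abs_nonneg s
  rcases le_total |s| 1 with h | h
  · have h4 : Real.exp (-c * r * t) ≤ Real.exp a * Real.exp (-(a * |s| ^ n * (1 + t))) := by
      rw [← Real.exp_add]
      apply Real.exp_le_exp.2
      have h5 := hlow h
      have h6 := mul_le_mul_of_nonneg_left (pow_le_one₀ (n := n) hs h) ha
      linarith
    calc |s| ^ j * x ≤ |s| ^ j * (C * (Real.exp a * Real.exp (-(a * |s| ^ n * (1 + t)))) * I) := by
          refine mul_le_mul_of_nonneg_left (hx.trans ?_) (by positivity)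
          gcongr
      _ = C * Real.exp a * I * (|s| ^ j * Real.exp (-(a * |s| ^ n * (1 + t)))) := by ring
      _ ≤ _ := le_add_of_nonneg_right (by positivity)
  · calc |s| ^ j * x ≤ |s| ^ j * (C * (B * |s| ^ l) * x₀) := by
          refine mul_le_mul_of_nonneg_left (hx.trans ?_) (by positivity)
          gcongr
          exact hhigh h
      _ = C * B * (|s| ^ (j + l) * x₀) := by rw [pow_add]; ring
      _ ≤ _ := le_add_of_nonneg_left (by positivity)

/-- A pointwise bound by a linear combination gives a bound of the `L²` norms. -/
theorem memLp_and_toReal_eLpNorm_le {G q : ℝ → Vec} {P : ℝ → ℝ} {α β K : ℝ} (hα : 0 ≤ α)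
    (hβ : 0 ≤ β) (hK : 0 ≤ K) (hG : AEStronglyMeasurable G volume) (hP : MemLp P 2 volume)
    (hPK : eLpNorm P 2 volume ≤ ENNReal.ofReal K) (hq : MemLp q 2 volume)
    (h : ∀ᵐ ξ, ‖G ξ‖ ≤ α * P ξ + β * ‖q ξ‖) :
    MemLp G 2 volume ∧
      (eLpNorm G 2 volume).toReal ≤ α * K + β * (eLpNorm q 2 volume).toReal := by
  have h' : ∀ᵐ ξ, ‖G ξ‖ ≤ (α • P + β • fun ξ => ‖q ξ‖) ξ := h
  have hPm : MemLp (α • P) 2 volume := hP.const_smul α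
  have hqm : MemLp (β • fun ξ => ‖q ξ‖) 2 volume := hq.norm.const_smul β
  refine ⟨(hPm.add hqm).mono' hG h', ?_⟩
  have h1 : eLpNorm G 2 volume ≤ ENNReal.ofReal α * ENNReal.ofReal K +
      ENNReal.ofReal β * eLpNorm q 2 volume := by
    refine (eLpNorm_mono_ae_real h').trans ((eLpNorm_add_le hPm.1 hqm.1 one_le_two).trans ?_)
    rw [eLpNorm_const_smul, eLpNorm_const_smul, eLpNorm_norm, Real.enorm_of_nonneg hα,
      Real.enorm_of_nonneg hβ]
    gcongr
  have hfin : ENNReal.ofReal β * eLpNorm q 2 volume ≠ ⊤ :=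
    ENNReal.mul_ne_top ENNReal.ofReal_ne_top hq.2.ne
  have hfin' : ENNReal.ofReal α * ENNReal.ofReal K ≠ ⊤ :=
    ENNReal.mul_ne_top ENNReal.ofReal_ne_top ENNReal.ofReal_ne_top
  refine (ENNReal.toReal_mono (ENNReal.add_ne_top.2 ⟨hfin', hfin⟩) h1).trans (le_of_eq ?_)
  rw [ENNReal.toReal_add hfin' hfin, ENNReal.toReal_mul, ENNReal.toReal_mul,
    ENNReal.toReal_ofReal hα, ENNReal.toReal_ofReal hK, ENNReal.toReal_ofReal hβ]

/-! ### Decay estimates for solutions -/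

/-- Decay of the symbol at low and high frequencies gives decay of the solutions. -/
theorem exists_decayEstimate {d : Dissipation} {p : Coeffs} {f : ℝ → ℝ} {n : ℕ} (hn : 0 < n)
    {κ : ℝ} (hκ : 0 < κ) (hlow : ∀ s, |s| ≤ 1 → κ * |s| ^ n ≤ f s) {N l j : ℕ} (hjl : j + l ≤ N)
    {C c : ℝ} (hC : 0 < C) (hc : 0 < c)
    (hexp : ∀ (ξ : ℝ) (x : Vec) (t : ℝ), 0 ≤ t → ‖NormedSpace.exp (t • symbol d p ξ) x‖ ≤
      C * Real.exp (-c * f (2 * Real.pi * ξ) * t) * ‖x‖)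
    {B : ℝ → ℝ} (hB : ∀ t, 0 ≤ t → 0 ≤ B t)
    (hhigh : ∀ s t, 1 ≤ |s| → 0 ≤ t → Real.exp (-c * f s * t) ≤ B t * |s| ^ l) :
    ∃ K > 0, ∀ (U₀ : L2) (U : ℝ → L2), AdmissibleData N U₀ → IsSolution d p U₀ U →
      DecayEstimate j l (fun t => K * (1 + t) ^ (-(1 / (2 * (n : ℝ))) - (j : ℝ) / n))
        (fun t => C * B t) U₀ U := by
  obtain ⟨K₀, hK₀, hprofile⟩ := exists_eLpNorm_profile_le j hn (mul_pos hc hκ)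
  refine ⟨C * Real.exp (c * κ) * K₀, by positivity, fun U₀ U hU₀ hU t ht => ?_⟩
  obtain ⟨hP, hP'⟩ := hprofile (1 + t) (by linarith)
  have hI0 : 0 ≤ ∫ x, ‖U₀ x‖ := integral_nonneg fun _ => norm_nonneg _
  have hq := memLp_freq_pow_smul hjl hU₀.1
  -- By Plancherel only `freq^j Û(t)` has to be measured: at low frequencies `Û₀` is bounded by
  -- `‖U₀‖_{L¹}`, at high frequencies it is kept with `j + l` powers of the frequency.
  obtain ⟨hmem, hle⟩ := memLp_and_toReal_eLpNorm_le
    (α := C * Real.exp (c * κ) * ∫ x, ‖U₀ x‖) (β := C * B t)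
    (K := K₀ * (1 + t) ^ (-(1 / (2 * (n : ℝ))) - (j : ℝ) / n))
    (mul_nonneg (by positivity) hI0) (mul_nonneg hC.le (hB t ht)) (by positivity)
    (aestronglyMeasurable_freq_pow_smul j (𝓕 (U t) : L2)) hP hP' hq (by
      filter_upwards [hU.fourier_ae_eq ht, norm_fourier_le hU₀.2] with ξ h1 h2
      rw [norm_smul, norm_pow, norm_freq, norm_smul, norm_pow, norm_freq]
      have h3 := hexp ξ ((𝓕 U₀ : L2) ξ) t ht
      rw [← h1] at h3
      refine freq_bound (mul_pos hc hκ).le hC.le (hB t ht) hI0 (norm_nonneg _) h2 h3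
        (fun h => ?_) (fun h => hhigh _ t h ht)
      have := mul_le_mul_of_nonneg_left (hlow _ h) (mul_nonneg hc.le ht)
      linarith)
  refine ⟨𝓕⁻ (hmem.toLp _), 𝓕⁻ (hq.toLp _), isL2Deriv_fourierInv hmem.coeFn_toLp,
    isL2Deriv_fourierInv hq.coeFn_toLp, ?_⟩
  rw [fourier_symm_norm, fourier_symm_norm, Lp.norm_toLp, Lp.norm_toLp]
  refine hle.trans (le_of_eq ?_)
  ring

/-- The high frequency lower bound for the rates. -/
theorem le_inv_one_add_sq_pow {s : ℝ} (hs : 1 ≤ |s|) (k : ℕ) :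
    1 / 2 ^ k / |s| ^ (2 * k) ≤ ((1 + s ^ 2)⁻¹) ^ k := by
  have h1 : 1 + s ^ 2 ≤ 2 * |s| ^ 2 := by nlinarith [sq_abs s]
  rw [pow_mul, inv_pow, div_div, ← mul_pow, one_div]
  gcongr

/-- The low frequency lower bound for the rates. -/
theorem le_inv_one_add_sq_pow_of_le {s : ℝ} (hs : |s| ≤ 1) (k : ℕ) :
    1 / 2 ^ k ≤ ((1 + s ^ 2)⁻¹) ^ k := by
  have h1 : 1 + s ^ 2 ≤ 2 := by nlinarith [sq_abs s, abs_nonneg s]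
  rw [inv_pow, one_div]
  gcongr

/-- Decay with loss of regularity, for a rate behaving like `|s| ^ n` at low frequencies and like
`|s| ^ (-m)` at high frequencies. -/
theorem exists_decayEstimate_of_loss {d : Dissipation} {p : Coeffs} (h₁ : p.τ₁ = 0)
    (h₂ : p.τ₂ = 0) (h₃ : p.τ₃ = 1) (hk₅ : 0 < p.k₅) {k n m : ℕ} (hn : 0 < n) (hm : 0 < m)
    (hne : Even n) (hk : 2 * k = n + m)
    (h : ∃ C > 0, ∃ c > 0, ∀ X : Mode p, X.D = damping d p X.s → ∀ t, 0 ≤ t →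
      X.normSq t ≤ C * Real.exp (-c * (((1 + X.s ^ 2)⁻¹) ^ k * X.s ^ n) * t) * X.normSq 0)
    {N l j : ℕ} (hl : 1 ≤ l) (hjl : j + l ≤ N) :
    ∃ K > 0, ∀ (U₀ : L2) (U : ℝ → L2), AdmissibleData N U₀ → IsSolution d p U₀ U →
      DecayEstimate j l (fun t => K * (1 + t) ^ (-(1 / (2 * (n : ℝ))) - (j : ℝ) / n))
        (fun t => K * (1 + t) ^ (-((l : ℝ) / m))) U₀ U := by
  obtain ⟨C, hC, c, hc, hexp⟩ := exists_norm_exp_symbol_le h₁ h₂ h₃ hk₅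
    (f := fun s => ((1 + s ^ 2)⁻¹) ^ k * s ^ n) h
  obtain ⟨K, hK, hhigh⟩ := exists_exp_neg_div_le (c := c / 2 ^ k) (by positivity) hl hm
  obtain ⟨K', hK', hdecay⟩ := exists_decayEstimate (d := d) (p := p)
    (f := fun s => ((1 + s ^ 2)⁻¹) ^ k * s ^ n) hn (κ := 1 / 2 ^ k) (by positivity)
    (fun s hs => by
      rw [hne.pow_abs s]
      exact mul_le_mul_of_nonneg_right (le_inv_one_add_sq_pow_of_le hs k) (hne.pow_nonneg s))
    hjl hC hc hexp (B := fun t => K * (1 + t) ^ (-((l : ℝ) / m))) (fun t ht => by positivity)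
    (fun s t hs ht => by
      refine (Real.exp_le_exp.2 ?_).trans (hhigh s t hs ht)
      have h1 : 1 / 2 ^ k / |s| ^ m ≤ ((1 + s ^ 2)⁻¹) ^ k * s ^ n := by
        have h2 := mul_le_mul_of_nonneg_right (le_inv_one_add_sq_pow hs k)
          (by positivity : 0 ≤ |s| ^ n)
        rw [hne.pow_abs s] at h2
        refine le_trans (le_of_eq ?_) h2
        have hs0 : |s| ≠ 0 := by linarith
        rw [hk, pow_add, ← hne.pow_abs s]
        field_simp
      have h3 := mul_le_mul_of_nonneg_left h1 (by positivity : 0 ≤ c * t)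
      have h4 : c * t * (1 / 2 ^ k / |s| ^ m) = c / 2 ^ k / |s| ^ m * t := by ring
      linarith)
  refine ⟨max K' (C * K), lt_max_of_lt_left hK', fun U₀ U hU₀ hU =>
    decayEstimate_mono (hdecay U₀ U hU₀ hU) (fun t ht => ?_) (fun t ht => ?_)⟩
  · exact mul_le_mul_of_nonneg_right (le_max_left _ _) (by positivity)
  · rw [← mul_assoc]
    exact mul_le_mul_of_nonneg_right (le_max_right _ _) (by positivity)

/-- Decay without loss of regularity, for a rate behaving like `|s| ^ n` at low frequencies and
bounded from below at high frequencies. -/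
theorem exists_decayEstimate_of_no_loss {d : Dissipation} {p : Coeffs} (h₁ : p.τ₁ = 0)
    (h₂ : p.τ₂ = 0) (h₃ : p.τ₃ = 1) (hk₅ : 0 < p.k₅) {k n : ℕ} (hn : 0 < n)
    (hne : Even n) (hk : 2 * k = n)
    (h : ∃ C > 0, ∃ c > 0, ∀ X : Mode p, X.D = damping d p X.s → ∀ t, 0 ≤ t →
      X.normSq t ≤ C * Real.exp (-c * (((1 + X.s ^ 2)⁻¹) ^ k * X.s ^ n) * t) * X.normSq 0)
    {N l j : ℕ} (hjl : j + l ≤ N) :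
    ∃ K > 0, ∃ K' > 0, ∀ (U₀ : L2) (U : ℝ → L2), AdmissibleData N U₀ → IsSolution d p U₀ U →
      DecayEstimate j l (fun t => K * (1 + t) ^ (-(1 / (2 * (n : ℝ))) - (j : ℝ) / n))
        (fun t => K * Real.exp (-K' * t)) U₀ U := by
  obtain ⟨C, hC, c, hc, hexp⟩ := exists_norm_exp_symbol_le h₁ h₂ h₃ hk₅
    (f := fun s => ((1 + s ^ 2)⁻¹) ^ k * s ^ n) h
  obtain ⟨K', hK', hdecay⟩ := exists_decayEstimate (d := d) (p := p)
    (f := fun s => ((1 + s ^ 2)⁻¹) ^ k * s ^ n) hn (κ := 1 / 2 ^ k) (by positivity)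
    (fun s hs => by
      rw [hne.pow_abs s]
      exact mul_le_mul_of_nonneg_right (le_inv_one_add_sq_pow_of_le hs k) (hne.pow_nonneg s))
    hjl hC hc hexp (B := fun t => Real.exp (-(c / 2 ^ k) * t)) (fun t ht => by positivity)
    (fun s t hs ht => by
      -- The factor `|s|^l ≥ 1` is inserted for free, so `l = 0` is allowed here.
      refine (Real.exp_le_exp.2 ?_).trans
        (le_mul_of_one_le_right (Real.exp_pos _).le (one_le_pow₀ hs))
      have h1 : 1 / 2 ^ k ≤ ((1 + s ^ 2)⁻¹) ^ k * s ^ n := by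
        have h2 := mul_le_mul_of_nonneg_right (le_inv_one_add_sq_pow hs k)
          (by positivity : 0 ≤ |s| ^ n)
        rwa [hk, div_mul_cancel₀ _ (by positivity), hne.pow_abs s] at h2
      have h3 := mul_le_mul_of_nonneg_left h1 (by positivity : 0 ≤ c * t)
      have h4 : c * t * (1 / 2 ^ k) = c / 2 ^ k * t := by ring
      linarith)
  refine ⟨max K' C, lt_max_of_lt_left hK', c / 2 ^ k, by positivity, fun U₀ U hU₀ hU =>
    decayEstimate_mono (hdecay U₀ U hU₀ hU) (fun t ht => ?_) (fun t ht => ?_)⟩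
  · exact mul_le_mul_of_nonneg_right (le_max_left _ _) (by positivity)
  · exact mul_le_mul_of_nonneg_right (le_max_right _ _) (by positivity)

end LaminatedBeam

theorem mainTheorem4 (k₁ k₂ k₃ k₄ k₅ γ : ℝ) (hk₁ : 0 < k₁) (hk₂ : 0 < k₂) (hk₃ : 0 < k₃)
    (hk₄ : 0 < k₄) (hk₅ : 0 < k₅) (hγ : γ ≠ 0)
    (p : LaminatedBeam.Coeffs) (hp : p = ⟨k₁, k₂, k₃, k₄, k₅, γ, 0, 0, 1⟩) :
    ((k₁ = k₂ ∧ k₂ = k₃) → ∀ N l j : ℕ, j + l ≤ N →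
      ∃ c > (0 : ℝ), ∃ c' > (0 : ℝ), ∀ (U₀ : LaminatedBeam.L2) (U : ℝ → LaminatedBeam.L2),
        LaminatedBeam.AdmissibleData N U₀ → LaminatedBeam.IsSolution .higherOrder p U₀ U →
        LaminatedBeam.DecayEstimate j l
          (fun t => c * (1 + t) ^ (-(1 / 12 : ℝ) - (j : ℝ) / 6))
          (fun t => c * Real.exp (-c' * t)) U₀ U) ∧
    (¬ (k₁ = k₂ ∧ k₂ = k₃) → ∀ N l j : ℕ, 1 ≤ l → j + l ≤ N →
      ∃ c > (0 : ℝ), ∀ (U₀ : LaminatedBeam.L2) (U : ℝ → LaminatedBeam.L2),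
        LaminatedBeam.AdmissibleData N U₀ → LaminatedBeam.IsSolution .higherOrder p U₀ U →
        LaminatedBeam.DecayEstimate j l
          (fun t => c * (1 + t) ^ (-(1 / 12 : ℝ) - (j : ℝ) / 6))
          (fun t => c * (1 + t) ^ (-((l : ℝ) / 4))) U₀ U) ∧
    ((k₁ = k₂ ∧ k₂ = k₃) → ∀ N l j : ℕ, 1 ≤ l → j + l ≤ N →
      ∃ c > (0 : ℝ), ∀ (U₀ : LaminatedBeam.L2) (U : ℝ → LaminatedBeam.L2),
        LaminatedBeam.AdmissibleData N U₀ → LaminatedBeam.IsSolution .lowerOrder p U₀ U →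
        LaminatedBeam.DecayEstimate j l
          (fun t => c * (1 + t) ^ (-(1 / 8 : ℝ) - (j : ℝ) / 4))
          (fun t => c * (1 + t) ^ (-((l : ℝ) / 2))) U₀ U) ∧
    (¬ (k₁ = k₂ ∧ k₂ = k₃) → ∀ N l j : ℕ, 1 ≤ l → j + l ≤ N →
      ∃ c > (0 : ℝ), ∀ (U₀ : LaminatedBeam.L2) (U : ℝ → LaminatedBeam.L2),
        LaminatedBeam.AdmissibleData N U₀ → LaminatedBeam.IsSolution .lowerOrder p U₀ U →
        LaminatedBeam.DecayEstimate j l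
          (fun t => c * (1 + t) ^ (-(1 / 8 : ℝ) - (j : ℝ) / 4))
          (fun t => c * (1 + t) ^ (-((l : ℝ) / 4))) U₀ U) := by
  have h₁ : p.τ₁ = 0 := by rw [hp]
  have h₂ : p.τ₂ = 0 := by rw [hp]
  have h₃ : p.τ₃ = 1 := by rw [hp]
  have e12 : (-(1 / (2 * ((6 : ℕ) : ℝ)))) = -(1 / 12) := by norm_num
  have e8 : (-(1 / (2 * ((4 : ℕ) : ℝ)))) = -(1 / 8) := by norm_num
  obtain rfl : p.k₁ = k₁ := by rw [hp]
  obtain rfl : p.k₂ = k₂ := by rw [hp]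
  obtain rfl : p.k₃ = k₃ := by rw [hp]
  obtain rfl : p.k₄ = k₄ := by rw [hp]
  obtain rfl : p.k₅ = k₅ := by rw [hp]
  obtain rfl : p.γ = γ := by rw [hp]
  clear hp
  refine ⟨fun heq N l j hjl => ?_, fun _ N l j hl hjl => ?_, fun heq N l j hl hjl => ?_,
    fun _ N l j hl hjl => ?_⟩
  · obtain ⟨C, hC, c, hc, h⟩ := LaminatedBeam.Mode.higherOrder_decay_of_eq hk₁ hk₂ hk₃ hk₄ hk₅ hγ
      heq.1 (heq.1.trans heq.2)
    -- The rate is `ρ²s² · ρs⁴ = ρ³s⁶`. As `l` is arbitrary, the estimate without loss of regularity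
    -- is included.
    obtain ⟨K, hK, K', hK', hdecay⟩ := LaminatedBeam.exists_decayEstimate_of_no_loss
      (d := .higherOrder) (k := 3) (n := 6) h₁ h₂ h₃ hk₅ (by norm_num) (by decide) rfl
      ⟨C, hC, c, hc, fun X hX t ht => by
        convert h X hX t ht using 5
        rw [LaminatedBeam.Mode.ρ]; ring⟩ hjl
    rw [e12] at hdecay
    exact ⟨K, hK, K', hK', hdecay⟩
  · obtain ⟨C, hC, c, hc, h⟩ :=
      (LaminatedBeam.Mode.isWeight_higherOrder hk₅).decay hk₁ hk₂ hk₃ hk₄ hγ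
    -- The rate is `ρ²s² · ρ³s⁴ = ρ⁵s⁶`, of order `s⁻⁴` at high frequencies.
    obtain ⟨K, hK, hdecay⟩ := LaminatedBeam.exists_decayEstimate_of_loss
      (d := .higherOrder) (k := 5) (n := 6) (m := 4) h₁ h₂ h₃ hk₅ (by norm_num) (by norm_num)
      (by decide) rfl
      ⟨C, hC, c, hc, fun X hX t ht => by
        convert h X hX t ht using 5
        rw [LaminatedBeam.Mode.ρ]; ring⟩ hl hjl
    rw [e12] at hdecay
    exact ⟨K, hK, hdecay⟩
  · obtain ⟨C, hC, c, hc, h⟩ :=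
      (LaminatedBeam.Mode.isWeight_lowerOrder hk₅).decay_of_eq hk₁ hk₂ hk₃ hk₄ hγ heq.1
    -- The rate is `ρ · ρ²s⁴ = ρ³s⁴`, of order `s⁻²` at high frequencies; only `k₁ = k₂` is needed.
    obtain ⟨K, hK, hdecay⟩ := LaminatedBeam.exists_decayEstimate_of_loss
      (d := .lowerOrder) (k := 3) (n := 4) (m := 2) h₁ h₂ h₃ hk₅ (by norm_num) (by norm_num)
      (by decide) rfl
      ⟨C, hC, c, hc, fun X hX t ht => by
        convert h X hX t ht using 5
        rw [LaminatedBeam.Mode.ρ]; ring⟩ hl hjl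
    rw [e8] at hdecay
    exact ⟨K, hK, hdecay⟩
  · obtain ⟨C, hC, c, hc, h⟩ :=
      (LaminatedBeam.Mode.isWeight_lowerOrder hk₅).decay hk₁ hk₂ hk₃ hk₄ hγ
    -- The rate is `ρ · ρ³s⁴ = ρ⁴s⁴`, of order `s⁻⁴` at high frequencies.
    obtain ⟨K, hK, hdecay⟩ := LaminatedBeam.exists_decayEstimate_of_loss
      (d := .lowerOrder) (k := 4) (n := 4) (m := 4) h₁ h₂ h₃ hk₅ (by norm_num) (by norm_num)
      (by decide) rfl
      ⟨C, hC, c, hc, fun X hX t ht => by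
        convert h X hX t ht using 5
        rw [LaminatedBeam.Mode.ρ]; ring⟩ hl hjl
    rw [e8] at hdecay
    exact ⟨K, hK, hdecay⟩
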